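/- **Conventions.** A normed quasi-order (nwqo) $A$ is a quasi-order $\le_A$ with a norm $|\cdot|_A$ into $\mathbb N$. *Nested multiset nwqos* are built from the empty nwqo $\Gamma_0$ by disjoint sums $A+B$ (elements of different summands are incomparable, norms are inherited) and finite multisets $\mathbb M(A)$, where $m\le m'$ iff there is an injection from $m$ to $m'$ sending each element to a larger-or-equal one, and $|m|=\sum_{a\in m}(1+|a|)$. A finite antichain of $d$ elements (all of norm $0$) is the $d$-fold sum of the one-point nwqo $\mathbb M(\Gamma_0)$; write $A\cdot d$ for a $d$-fold sum. The depth of $A$ is the nesting depth of $\mathbb M$ counted from $\Gamma_0$; thus $k$ nested applications of $\mathbb M$ to finite antichains give depth at most $k+1$. A sequence $s_0,\dots,s_{L-1}$ in $A$ is *bad* if $s_i\le s_j$ for no $i<j$, and $(g,n)$-*controlled* if $|s_i|\le g^i(n)$ for all $i$; $L_{A,g}(n)$ is the maximal length of a $(g,n)$-controlled bad sequence. For a subset $S$ of an nwqo and an nwqo $B$, a *reflection* $S\hookrightarrow B$ is a map $r$ such that $r(x)\le r(y)$ implies $x\le y$ and $|r(x)|\le|x|$. Let $A/a=\{x\in A: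 a\not\le x\}$. Ordinals are below $\varepsilon_0$ and in Cantor normal form, $\oplus$ is the natural sum, $\gamma\cdot m$ inside $D_n$ below is the $m$-fold natural sum, $\Omega_0=1$, $\Omega_{k+1}=\omega^{\Omega_k}$. An ordinal is $\ell$-*lean* if all coefficients occurring hereditarily in its strict Cantor normal form are at most $\ell$. The order type is $o(\Gamma_0)=0$, $o(A+B)=o(A)\oplus o(B)$, $o(\mathbb M(A))=\omega^{o(A)}$, and $C(\alpha)$ is given by $C\big(\sum_i\omega^{\beta_i}\big)=\sum_i\mathbb M(C(\beta_i))$. For $\beta=\sum_{i}\omega^{\eta_i}$ put $$D_n(\omega^\beta)=\bigoplus_i \omega^{\,\bigoplus_{p\ne i}\omega^{\eta_p}\ \oplus\ \eta_i\cdot(n-1)\ \oplus\ D_n(\omega^{\eta_i})}\cdot n ,$$ so $D_n(1)=0$ and $D_0=0$; and for $\alpha=\sum_i\omega^{\beta_i}$ let $\delta_n(\alpha)=\{\bigoplus_{p\neq i}\omega^{\beta_p}\oplus D_n(\omega^{\beta_i})\}_i$. Let $M_{\alpha,g}(n)=\max_{\alpha'\in\delta_n(\alpha)}\big(1+M_{\alpha',g}(g(n))\big)$,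 with $M_{0,g}(n)=0$. For $a\in A$ the nwqo $R_n(A,a)$ is defined by: $R_n(B+C,b)=R_n(B,b)+C$ for $b\in B$, and symmetrically for elements of $C$; $R_n(\mathbb M(\Gamma_0),\emptyset)=\Gamma_0$; if $a\in\mathbb M(B+C)$ has parts $b\in\mathbb M(B)$, $c\in\mathbb M(C)$ and $R_n(\mathbb M(B),b)=\sum_j\mathbb M(B_j)$, $R_n(\mathbb M(C),c)=\sum_j\mathbb M(C_j)$, then $R_n(\mathbb M(B+C),a)=\sum_j\mathbb M(B_j+C)+\sum_j\mathbb M(B+C_j)$; and $R_n(\mathbb M(\mathbb M(B)),\{a_1,\dots,a_d\})=\sum_{i=1}^d\mathbb M\big(B\cdot(n-1)+R_n(\mathbb M(B),a_i)\big)$. Fundamental sequences are $(\gamma+\omega^{\beta+1})_x=\gamma+\omega^\beta\cdot x$ and $(\gamma+\omega^\lambda)_x=\gamma+\omega^{\lambda_x}$. For $h:\mathbb N\to\mathbb N$ the Cichoń functions are $h_0(x)=0$, $h_{\alpha+1}(x)=1+h_\alpha(h(x))$, $h_\lambda(x)=h_{\lambda_x}(x)$, and the fast-growing functions are $F_0(x)=x+1$,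 $F_{\alpha+1}(x)=F_\alpha^x(x)$, $F_\lambda(x)=F_{\lambda_x}(x)$. **Theorem.** Let $g:\mathbb N\to\mathbb N$ be strictly increasing and superadditive ($g(x)+g(y)\le g(x+y)$ for all $x,y$), let $h(x)=x\cdot g(x)$, and let $k\in\mathbb N$. 1. If a nested multiset nwqo $A$ has depth at most $k+1$, then $o(A)<\Omega_{k+1}$. 2. For every nested multiset nwqo $A$, $n\in\mathbb N$ and $a\in A$ with $|a|\le n$, there are reflections $A/a\hookrightarrow R_n(A,a)$ and $R_n(A,a)\hookrightarrow C(\alpha')$ for some $\alpha'\in\delta_n(o(A))$. 3. If $\omega^\beta<\Omega_{k+1}$ is $\ell$-lean, then $D_n(\omega^\beta)$ is $\ell nk$-lean. If $\alpha<\Omega_{k+1}$ is $\ell$-lean, then every $\alpha'\in\delta_n(\alpha)$ is $(\ell+\ell nk)$-lean. 4. If $\alpha<\Omega_{k+1}$ is $\ell$-lean, then $M_{\alpha,g}(n)\le h_\alpha(\ell+\ell nk)$ for all $n$. 5. If $A$ is a nested multiset nwqo whose order type $\alpha=o(A)<\Omega_{k+1}$ is $\ell$-lean, then for every $n$ the maximal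 length $L_{A,g}(n)$ of $(g,n)$-controlled bad sequences over $A$ exists, and $L_{A,g}(n)\le M_{\alpha,g}(n)$ and $L_{A,g}(n)\le h_\alpha(\ell+\ell nk)$. 6. Suppose moreover that $k\ge1$ and $g$ is primitive recursive, and let $e:\mathbb N\to\mathbb N$ be primitive recursive. Then there is a primitive recursive $p$ with $e(\ell+n+M_{\alpha,g}(n))\le F_{\Omega_k}(p(\ell+n))$ for all $\ell,n$ and all $\ell$-lean $\alpha<\Omega_{k+1}$. Consequently, if a decision problem is solved by a deterministic Turing machine whose running time on inputs of size $N$ is at most $e\big(N+L_{A_N,g}(n_N)\big)$, where the $A_N$ are nested multiset nwqos of depth at most $k+1$ with $\ell_N$-lean order type and $N\mapsto \ell_N,n_N$ are primitive recursive, then it is solvable by a deterministic Turing machine in time $F_{\Omega_k}(p(N))$ for some primitive recursive $p$, and hence lies in $\mathbf F_{\Omega_k}$. -/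

import Mathlib

/-! ### Ordinals below `ε₀`

Ordinals below `ε₀` are represented by Mathlib's Cantor normal forms: `ONote.oadd e c a` is
`ω ^ e * c + a`, and `NONote` is the type of notations in (strict, hereditary) normal form. -/

namespace ONote

/-- `ω ^ e * c + t`, where the coefficient `c` is allowed to be `0`. -/
def consTerm (e : ONote) (c : ℕ) (t : ONote) : ONote :=
  if h : 0 < c then oadd e ⟨c, h⟩ t else t

/-- Natural sum of `ω ^ f * m` and an ordinal. -/
def insertTerm (f : ONote) (m : ℕ+) : ONote → ONote
  | zero => oadd f m zero
  | oadd e c a =>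
    match cmp f e with
    | Ordering.gt => oadd f m (oadd e c a)
    | Ordering.eq => oadd e (c + m) a
    | Ordering.lt => oadd e c (insertTerm f m a)

/-- The natural (Hessenberg) sum `α ⊕ β`. -/
def natSum : ONote → ONote → ONote
  | zero, b => b
  | oadd e c a, b => insertTerm e c (natSum a b)

/-- The `m`-fold natural sum `α ⊕ ⋯ ⊕ α`. -/
def natMul (a : ONote) : ℕ → ONote
  | 0 => 0
  | m + 1 => natSum a (natMul a m)

/-- `shift t (⨁ⱼ ω ^ βⱼ) = ⨁ⱼ ω ^ (t ⊕ βⱼ)`. -/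
def shift (t : ONote) : ONote → ONote
  | zero => 0
  | oadd f m a => insertTerm (natSum t f) m (shift t a)

/-- `expDeriv n β` is the ordinal `Dₙ(ω ^ β)`. For `β = ⨁ᵢ ω ^ γᵢ * cᵢ` in strict normal form it is
`⨁ᵢ ω ^ (⨁_{p ≠ i} ω ^ γₚ * cₚ ⊕ ω ^ γᵢ * (cᵢ - 1) ⊕ γᵢ * (n - 1) ⊕ Dₙ(ω ^ γᵢ)) * (cᵢ * n)`;
the recursion splits off the leading term of `β`. -/
def expDeriv (n : ℕ) : ONote → ONote
  | zero => 0
  | oadd γ c b =>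
    natSum
      (consTerm
        (natSum (consTerm γ (c - 1) 0) (natSum b (natSum (natMul γ (n - 1)) (expDeriv n γ))))
        (c * n) 0)
      (shift (oadd γ c 0) (expDeriv n b))

/-- `derivList n α` lists `δₙ(α)`: the ordinals obtained from `α = ⨁ᵢ ω ^ βᵢ` by replacing one
summand `ω ^ βᵢ` by `Dₙ(ω ^ βᵢ)`. -/
def derivList (n : ℕ) : ONote → List ONote
  | zero => []
  | oadd e c a =>
    natSum (consTerm e (c - 1) 0) (natSum a (expDeriv n e)) ::
      (derivList n a).map (natSum (oadd e c 0))

/-- All coefficients occurring (hereditarily) in the normal form are at most `ℓ`. -/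
def IsLean (ℓ : ℕ) : ONote → Prop
  | zero => True
  | oadd e c a => IsLean ℓ e ∧ (c : ℕ) ≤ ℓ ∧ IsLean ℓ a

/-- `towerNote k` is `Ω_k`, with `Ω_0 = 1`, `Ω_1 = ω` and `Ω_{k+1} = ω ^ Ω_k`. -/
def towerNote : ℕ → ONote
  | 0 => 1
  | k + 1 => oadd (towerNote k) 1 0

/-- Whether `α` is a successor, i.e. the last term of its normal form is finite. -/
def isSucc : ONote → Bool
  | zero => false
  | oadd e _ a => if a = 0 then decide (e = 0) else isSucc a

/-- For a limit `λ`, `fundSeq λ x` is the element `λ_x` of the fundamental sequence given by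
`(γ + ω ^ (β + 1))_x = γ + ω ^ β * x` and `(γ + ω ^ λ)_x = γ + ω ^ λ_x`.
For a successor `α = β + 1` the value is `β`, for every `x`. -/
def fundSeq : ONote → ℕ → ONote
  | zero, _ => 0
  | oadd e c a, x =>
    if a = 0 then
      consTerm e (c - 1)
        (if e = 0 then 0
         else if isSucc e then consTerm (fundSeq e x) x 0
         else consTerm (fundSeq e x) 1 0)
    else oadd e c (fundSeq a x)

/-! #### Facts needed for the recursions below -/

theorem isSucc_repr : ∀ (a : ONote) (x : ℕ), isSucc a = true → repr a = repr (fundSeq a x) + 1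
  | zero, _, h => by simp [isSucc] at h
  | oadd e c a, x, h => by
    rw [isSucc] at h
    rw [fundSeq]
    split_ifs at h ⊢ with h0 h1 h2
    · subst h0 h1
      unfold consTerm
      split_ifs with hc
      · have hc' : ((c : ℕ) : Ordinal.{0}) = (((c : ℕ) - 1 : ℕ) : Ordinal.{0}) + 1 := by
          have hn : (c : ℕ) = (c : ℕ) - 1 + 1 := by omega
          exact_mod_cast congrArg (Nat.cast (R := Ordinal.{0})) hn
        simp only [repr]
        rw [hc']
        simp
      · have hpos : 0 < (c : ℕ) := c.2
        have hc' : (c : ℕ) = 1 := by omega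
        simp only [repr, hc']
        simp
    · simp [h1] at h
    · simp [h1] at h
    · have := isSucc_repr a x h
      simp only [repr]
      rw [this, add_assoc]

theorem fundSeq_lt : ∀ (a : ONote) (x : ℕ), a ≠ 0 → fundSeq a x < a
  | zero, _, h => absurd rfl h
  | oadd e c a, x, _ => by
    rw [fundSeq]
    split_ifs with h0 h1 h2
    all_goals rw [lt_def]
    · subst h0 h1
      unfold consTerm
      split_ifs with hc
      · simp only [repr, PNat.mk_coe]
        have hlt : (c : ℕ) - 1 < c := by omega
        have hlt' : (((c : ℕ) - 1 : ℕ) : Ordinal.{0}) < ((c : ℕ) : Ordinal.{0}) :=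
          Nat.cast_lt.2 hlt
        simpa [-Nat.cast_lt, -Nat.cast_pred] using hlt'
      · exact oadd_pos _ _ _
    all_goals try
      have key : ∀ t : ONote, repr t < Ordinal.omega0 ^ repr e →
          repr (consTerm e (c - 1) t) < repr (oadd e c a) := by
        intro t ht
        unfold consTerm
        split_ifs with hc
        · have hc' : (c : ℕ) = (c : ℕ) - 1 + 1 := by omega
          simp only [repr, PNat.mk_coe]
          conv_rhs => rw [hc']
          rw [h0, repr_zero, add_zero, Nat.cast_add, Nat.cast_one, mul_add, mul_one]
          exact (add_lt_add_iff_left _).2 ht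
        · exact ht.trans_le (omega0_le_oadd _ _ _)
    · apply key
      have hlt := fundSeq_lt e x h1
      unfold consTerm
      split_ifs with hx
      · simp only [repr, PNat.mk_coe, add_zero]
        exact Ordinal.opow_mul_lt_opow (Ordinal.natCast_lt_omega0 _) hlt
      · exact Ordinal.opow_pos _ Ordinal.omega0_pos
    · apply key
      have hlt := fundSeq_lt e x h1
      unfold consTerm
      simpa [repr] using lt_def.1 hlt
    · have := fundSeq_lt a x h0
      exact oadd_lt_oadd_3 this

theorem nfBelow_self : ∀ {a : ONote}, NF a → NFBelow a (repr a)
  | zero, _ => NFBelow.zero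
  | oadd _ _ _, h =>
    h.below_of_lt (((nfBelow_self h.fst).repr_lt).trans_le (omega0_le_oadd _ _ _))

theorem consTerm_below {e : ONote} {c : ℕ} {b : Ordinal} (he : NF e) (hb : repr e < b) :
    NFBelow (consTerm e c 0) b := by
  unfold consTerm
  split_ifs
  · exact NFBelow.oadd he NFBelow.zero hb
  · exact NFBelow.zero

theorem insertTerm_below {f : ONote} {m : ℕ+} {b : Ordinal} (hf : NF f) (hb : repr f < b) :
    ∀ {x : ONote}, NFBelow x b → NFBelow (insertTerm f m x) b
  | zero, _ => NFBelow.oadd hf NFBelow.zero hb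
  | oadd e c a, h => by
    have he := h.fst
    have hc := cmp_compares f e
    rw [insertTerm]
    cases hcmp : cmp f e <;> rw [hcmp] at hc <;> simp only [Ordering.Compares] at hc
    · exact NFBelow.oadd he (insertTerm_below hf hc h.snd) h.lt
    · exact NFBelow.oadd he h.snd h.lt
    · exact NFBelow.oadd hf (NFBelow.oadd he h.snd hc) hb

theorem natSum_below {b : Ordinal} :
    ∀ {x y : ONote}, NFBelow x b → NFBelow y b → NFBelow (natSum x y) b
  | zero, _, _, hy => hy
  | oadd _ _ _, _, hx, hy =>
    insertTerm_below hx.fst hx.lt (natSum_below (hx.snd.mono hx.lt.le) hy)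

theorem natSum_nf {x y : ONote} (hx : NF x) (hy : NF y) : NF (natSum x y) := by
  obtain ⟨b, hb⟩ := hx
  obtain ⟨c, hc⟩ := hy
  exact ⟨_, natSum_below (hb.mono (le_max_left b c)) (hc.mono (le_max_right b c))⟩

theorem natMul_below {b : Ordinal} {x : ONote} (hx : NFBelow x b) :
    ∀ m, NFBelow (natMul x m) b
  | 0 => NFBelow.zero
  | m + 1 => natSum_below hx (natMul_below hx m)

theorem insertTerm_of_below {f : ONote} {m : ℕ+} (hf : NF f) {x : ONote}
    (hx : NFBelow x (repr f)) : insertTerm f m x = oadd f m x := by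
  cases x with
  | zero => rfl
  | oadd e c a =>
    have he := hx.fst
    have hc := cmp_compares f e
    rw [insertTerm]
    have hlt : e < f := hx.lt
    cases hcmp : cmp f e <;> rw [hcmp] at hc <;> simp only [Ordering.Compares] at hc
    · exact absurd hc hlt.not_gt
    · exact absurd hc.symm (ne_of_lt hlt)

theorem natSum_consTerm_lt {γ : ONote} {c : ℕ+} {b y : ONote} (h : NF γ)
    (hy : NFBelow y (repr γ)) : natSum (consTerm γ (c - 1) 0) y < oadd γ c b := by
  unfold consTerm
  split_ifs with hc
  · have : natSum (oadd γ ⟨(c : ℕ) - 1, hc⟩ 0) y = oadd γ ⟨(c : ℕ) - 1, hc⟩ y :=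
      insertTerm_of_below h hy
    rw [this]
    exact oadd_lt_oadd_2 (h.oadd _ hy) (by simp only [PNat.mk_coe]; omega)
  · exact hy.repr_lt.trans_le (omega0_le_oadd _ _ _)

theorem shift_below {γ b : ONote} {c : ℕ+} (h : NF (oadd γ c b)) :
    ∀ {x : ONote}, NFBelow x (repr b) → NFBelow (shift (oadd γ c 0) x) (repr (oadd γ c b))
  | zero, _ => NFBelow.zero
  | oadd f m a, hx => by
    have hf : NFBelow f (repr γ) := NF.below_of_lt' (hx.lt.trans h.snd'.repr_lt) hx.fst
    have e : natSum (oadd γ c 0) f = oadd γ c f := insertTerm_of_below h.fst hf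
    rw [shift, e]
    exact insertTerm_below (h.fst.oadd _ hf) (oadd_lt_oadd_3 hx.lt)
      (shift_below h (hx.snd.mono hx.lt.le))

theorem expDeriv_below (n : ℕ) : ∀ {b : ONote}, NF b → NFBelow (expDeriv n b) (repr b)
  | zero, _ => NFBelow.zero
  | oadd γ c b, h => by
    rw [expDeriv]
    have hγ := h.fst
    have hy : NFBelow (natSum b (natSum (natMul γ (n - 1)) (expDeriv n γ))) (repr γ) :=
      natSum_below h.snd'
        (natSum_below (natMul_below (nfBelow_self hγ) _) (expDeriv_below n hγ))
    refine natSum_below (consTerm_below (natSum_nf ?_ ⟨_, hy⟩) (natSum_consTerm_lt hγ hy))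
      (shift_below h (expDeriv_below n h.snd))
    exact ⟨_, consTerm_below hγ (Order.lt_succ _)⟩

theorem derivList_spec (n : ℕ) :
    ∀ {a : ONote}, NF a → ∀ x ∈ derivList n a, NF x ∧ x < a
  | zero, _, x, hx => by simp [derivList] at hx
  | oadd e c a, h, x, hx => by
    rw [derivList, List.mem_cons, List.mem_map] at hx
    rcases hx with rfl | ⟨y, hy, rfl⟩
    · have hb := natSum_below h.snd' (expDeriv_below n h.fst)
      exact ⟨natSum_nf ⟨_, consTerm_below h.fst (Order.lt_succ _)⟩ ⟨_, hb⟩,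
        natSum_consTerm_lt h.fst hb⟩
    · obtain ⟨hy1, hy2⟩ := derivList_spec n h.snd y hy
      have hb : NFBelow y (repr e) :=
        NF.below_of_lt' (lt_trans (lt_def.1 hy2) h.snd'.repr_lt) hy1
      have e1 : natSum (oadd e c 0) y = oadd e c y := insertTerm_of_below h.fst hb
      rw [e1]
      exact ⟨h.fst.oadd _ hb, oadd_lt_oadd_3 hy2⟩

theorem towerNote_nf : ∀ k, NF (towerNote k)
  | 0 => nf_one
  | k + 1 => have := towerNote_nf k; NF.oadd_zero _ _

/-! #### The Cichoń and fast-growing hierarchies -/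

/-- The Cichoń hierarchy: `h_0(x) = 0`, `h_{α+1}(x) = 1 + h_α(h(x))`, `h_λ(x) = h_{λ_x}(x)`. -/
def cichon (h : ℕ → ℕ) (α : ONote) (x : ℕ) : ℕ :=
  if h0 : α = 0 then 0
  else
    have := fundSeq_lt α x h0
    if isSucc α then 1 + cichon h (fundSeq α x) (h x) else cichon h (fundSeq α x) x
termination_by α

/-- The fast-growing hierarchy over the successor function: `F_0(x) = x + 1`,
`F_{α+1}(x) = F_α^x(x)`, `F_λ(x) = F_{λ_x}(x)`. -/
def fastGrow (α : ONote) (x : ℕ) : ℕ :=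
  if h0 : α = 0 then x + 1
  else
    have := fundSeq_lt α x h0
    if isSucc α then (fun y => fastGrow (fundSeq α x) y)^[x] x else fastGrow (fundSeq α x) x
termination_by α

end ONote

namespace NONote

/-- `Ω_k` as a normal form. -/
def tower (k : ℕ) : NONote := ⟨ONote.towerNote k, ONote.towerNote_nf k⟩

/-- The list of the elements of `δₙ(α)`. -/
def deriv (n : ℕ) (α : NONote) : List NONote :=
  (ONote.derivList n α.1).attach.map fun x => ⟨x.1, (ONote.derivList_spec n α.2 x.1 x.2).1⟩

theorem lt_of_mem_deriv {n : ℕ} {α β : NONote} (h : β ∈ deriv n α) : β < α := by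
  obtain ⟨x, _, hx⟩ := List.mem_map.1 h
  rw [← hx]
  exact (ONote.derivList_spec n α.2 x.1 x.2).2

/-- `M_{α,g}(n) = max {1 + M_{β,g}(g(n)) : β ∈ δₙ(α)}`, with `max ∅ = 0`. -/
def maxLen (g : ℕ → ℕ) (α : NONote) (n : ℕ) : ℕ :=
  ((deriv n α).attach.map fun β =>
    have := lt_of_mem_deriv β.2
    1 + maxLen g β.1 (g n)).foldr max 0
termination_by α

end NONote

/-! ### Nested multiset normed well-quasi-orders -/

/-- Expressions for nested multiset nwqos: the empty nwqo, disjoint sums, and finite multisets.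
The one-point nwqo is `mset empty`, and an `m`-element antichain is an `m`-fold sum of it. -/
inductive NestedMultiset : Type
  | empty : NestedMultiset
  | sum : NestedMultiset → NestedMultiset → NestedMultiset
  | mset : NestedMultiset → NestedMultiset

namespace NestedMultiset

/-- The underlying set. -/
def Carrier : NestedMultiset → Type
  | empty => Empty
  | sum A B => Carrier A ⊕ Carrier B
  | mset A => Multiset (Carrier A)

/-- The quasi-order: componentwise on sums, and multiset embedding on multisets, i.e. `m ≤ m'` iff
there is an injection from `m` to `m'` that sends each element to a larger or equivalent one. -/
def le : (A : NestedMultiset) → A.Carrier → A.Carrier → Prop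
  | empty => fun _ _ => False
  | sum A B => Sum.LiftRel (le A) (le B)
  | mset A => fun m m' : Multiset A.Carrier => ∃ m₀ ≤ m', Multiset.Rel (le A) m m₀

/-- The norm; for multisets it is `∑_{a ∈ m} (1 + |a|)`. Elements of finite antichains have norm
`0`, and `mset` of the one-point nwqo is `ℕ` with its usual norm. -/
def norm : (A : NestedMultiset) → A.Carrier → ℕ
  | empty => fun _ => 0
  | sum A B => Sum.elim (norm A) (norm B)
  | mset A => fun m : Multiset A.Carrier => (m.map fun a => 1 + norm A a).sum

/-- The nesting depth of the multiset operator, counted from the empty nwqo. Finite antichains have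
depth at most `1`, so `k` nested applications of `mset` to finite antichains have depth at most
`k + 1`. -/
def depth : NestedMultiset → ℕ
  | empty => 0
  | sum A B => max (depth A) (depth B)
  | mset A => depth A + 1

/-- The order type: `o(∅) = 0`, `o(A + B) = o(A) ⊕ o(B)`, `o(mset A) = ω ^ o(A)`. -/
def orderType : NestedMultiset → NONote
  | empty => 0
  | sum A B => ⟨ONote.natSum (orderType A).1 (orderType B).1,
      ONote.natSum_nf (orderType A).2 (orderType B).2⟩
  | mset A => ⟨ONote.oadd (orderType A).1 1 0, have := (orderType A).2; ONote.NF.oadd_zero _ _⟩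

/-- The `m`-fold disjoint sum `A * m`. -/
def copies (A : NestedMultiset) : ℕ → NestedMultiset
  | 0 => empty
  | m + 1 => sum A (copies A m)

/-- The disjoint sum of a list. -/
def sumList : List NestedMultiset → NestedMultiset
  | [] => empty
  | A :: l => sum A (sumList l)

/-- The canonical nwqo `C(α)` of order type `α`: `C(⨁ᵢ ω ^ βᵢ) = ∑ᵢ mset (C(βᵢ))`. -/
def canon : ONote → NestedMultiset
  | ONote.zero => empty
  | ONote.oadd e c a => sum (copies (mset (canon e)) c) (canon a)

/-- Given a multiset `a` over `A`, the list of the `Aⱼ` with `Rₙ(mset A, a) = ∑ⱼ mset Aⱼ`: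
* the list is empty for `A = ∅`;
* for `A = B + C`, the elements of `a` are split between `B` and `C`, and the list consists of all
  `Bⱼ + C` and all `B + Cⱼ`;
* for `A = mset B` and `a = {a₁, …, a_d}`, it consists of
  `B * (n - 1) + Rₙ(mset B, aᵢ)` for `1 ≤ i ≤ d`. -/
noncomputable def residualList (n : ℕ) :
    (A : NestedMultiset) → Multiset A.Carrier → List NestedMultiset
  | empty => fun _ => []
  | sum A B => fun a : Multiset (A.Carrier ⊕ B.Carrier) =>
    (residualList n A (a.filterMap Sum.getLeft?)).map (fun X => sum X B) ++
      (residualList n B (a.filterMap Sum.getRight?)).map (fun Y => sum A Y)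
  | mset B => fun a : Multiset (Multiset B.Carrier) =>
    a.toList.map fun b => sum (copies B (n - 1)) (sumList ((residualList n B b).map mset))

/-- The nwqo `Rₙ(A, a)` into which the residual `A / a` reflects. -/
noncomputable def residual (n : ℕ) : (A : NestedMultiset) → A.Carrier → NestedMultiset
  | empty => fun _ => empty
  | sum A B => Sum.elim (fun a => sum (residual n A a) B) (fun b => sum A (residual n B b))
  | mset A => fun a : Multiset A.Carrier => sumList ((residualList n A a).map mset)

/-- A reflection `S ↪ B`, where the subset `S` of `A` carries the induced order and norm: a map `r`
such that `r x ≤ r y` implies `x ≤ y` and `|r x| ≤ |x|`. -/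
def ReflectsInto {A : NestedMultiset} (S : Set A.Carrier) (B : NestedMultiset) : Prop :=
  ∃ r : S → B.Carrier,
    (∀ x y : S, B.le (r x) (r y) → A.le x y) ∧ ∀ x : S, B.norm (r x) ≤ A.norm x

/-- A sequence `s₀, …, s_{L-1}` is bad if there are no `i < j` with `sᵢ ≤ sⱼ`. -/
def IsBad (A : NestedMultiset) {L : ℕ} (s : Fin L → A.Carrier) : Prop :=
  ∀ i j, i < j → ¬ A.le (s i) (s j)

/-- A sequence is `(g, n)`-controlled if `|sᵢ| ≤ gⁱ(n)` for all `i`. -/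
def IsControlled (A : NestedMultiset) (g : ℕ → ℕ) (n : ℕ) {L : ℕ} (s : Fin L → A.Carrier) : Prop :=
  ∀ i, A.norm (s i) ≤ g^[i] n

/-- The lengths of the `(g, n)`-controlled bad sequences over `A`. -/
def badLengths (A : NestedMultiset) (g : ℕ → ℕ) (n : ℕ) : Set ℕ :=
  {L | ∃ s : Fin L → A.Carrier, A.IsBad s ∧ A.IsControlled g n s}

/-- The length function `L_{A,g}(n)`. -/
noncomputable def lengthFun (A : NestedMultiset) (g : ℕ → ℕ) (n : ℕ) : ℕ :=
  sSup (A.badLengths g n)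

end NestedMultiset

/-- `P` is decided by a deterministic Turing machine in time `F_α(p(N))` on inputs of length `N`,
for some primitive recursive function `p`. -/
def DecidableInFastTime (α : ONote) (P : List Bool → Bool) : Prop :=
  ∃ p : ℕ → ℕ, Primrec p ∧
    ∃ T : Turing.TM2ComputableInTime (fun w : List Bool => w) Computability.encodeBool P,
      ∀ N, T.time N ≤ ONote.fastGrow α (p N)

/-!
Let `A` be a nested multiset nwqo and `s₀, s₁, …` a bad sequence over it. All later terms lie in the
residual `A / s₀`, and the length bound comes from replacing that residual by a structure of smaller
order type, again and again.

**Residuals.** The residual of a multiset `a` of multisets is controlled by Hall's theorem: if `a`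
does not embed into `x`, some `b ∈ a` is below none of the elements of `x` except for at most
`n - 1` of them. The exceptional elements are kept in `n - 1` copies of the underlying nwqo, and the
others are in the residual of `b` (`reflectsInto_residual_mset_mset`). Packing into copies forgets
which of the exceptional elements are empty multisets, so the empty elements of `a` are treated
separately, by the size of `x`. On disjoint sums, residuals satisfy a Leibniz rule, and so do the
ordinals `Dₙ` (`terms_expDeriv_natSum`); by induction the nwqo `Rₙ(A, a)` reflects into `C(α')` with
`α' ∈ δₙ(o(A))` (`residual_reflects_canon`). Together these give `L_{A,g} ≤ M_{o(A),g}`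
(`le_maxLen_of_mem_badLengths`).

**Natural sums.** A normal form is determined by the multiset `terms` of its exponents
(`terms_inj`), and natural sums are sums of such multisets. Identities between the recursively
defined `natSum`, `shift`, `expDeriv` and `derivList` are therefore identities of multisets. The
coefficients of a normal form are multiplicities in `terms`, and the exponents that different
summands of `β` contribute to `Dₙ(ω ^ β)` are different (`derivExponent_inj`), which bounds the
coefficients of `Dₙ(ω ^ β)`.

**From `M` to the Cichoń hierarchy.** An ordinal below a limit `λ` with coefficients below `x` is
below `λ_x` (`lt_fundSeq_of_isLean`), hence is reached by descending along fundamental sequences of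
index `x`. So all elements of `δₙ(α)` are reached from the ordinal with which the recursion for
`h_α(x)` continues (`descends_predAt_of_mem_derivList`), and monotonicity of the hierarchy along
descents gives `M_{α,g}(n) ≤ h_α(ℓ + ℓnk)` (`maxLen_le_cichon`).

**Fast-growing bounds.** A primitive recursive function is bounded by some Ackermann function
`ack m`. Over the base function `h = ack m`, the Hardy function of index `ω ^ e` is the fast-growing
function of index `e` built on `h` in place of the successor; for `e ≥ ω` this change of base is
absorbed by a constant shift of the argument (`hardy_opow_add_le_fastGrow`). An outer
primitive recursive function is absorbed by raising the leading coefficient of `α` by one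
(`exists_hardy_ge`), and the result is still below `Ω_{k+1} = ω ^ Ω_k`. The statement on decision
problems needs no new machine: its time bound is one of the bounds just established.
-/

/-! ### Normal forms as multisets of exponents -/

namespace ONote

/-- The exponents of the normal form, listed with multiplicity in decreasing order. -/
def termList : ONote → List ONote
  | zero => []
  | oadd e c a => List.replicate c e ++ termList a

/-- The multiset of exponents of the normal form: `α = ⨁ ω ^ e` over `e ∈ terms α`. -/
def terms (a : ONote) : Multiset ONote := termList a

@[simp] theorem terms_zero : terms 0 = 0 := rfl

@[simp] theorem terms_oadd (e : ONote) (c : ℕ+) (a : ONote) :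
    terms (oadd e c a) = Multiset.replicate c e + terms a := by
  simp only [terms, termList, ← Multiset.coe_add, Multiset.coe_replicate]

@[simp] theorem terms_consTerm (e : ONote) (c : ℕ) (t : ONote) :
    terms (consTerm e c t) = Multiset.replicate c e + terms t := by
  unfold consTerm
  split_ifs with h
  · exact terms_oadd e ⟨c, h⟩ t
  · simp [Nat.eq_zero_of_not_pos h]

@[simp] theorem terms_insertTerm (f : ONote) (m : ℕ+) :
    ∀ x, terms (insertTerm f m x) = Multiset.replicate m f + terms x
  | zero => by simp [insertTerm]
  | oadd e c a => by
    rw [insertTerm]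
    cases hcmp : cmp f e <;> simp only
    · rw [terms_oadd, terms_insertTerm f m a, terms_oadd]
      abel
    · rw [eq_of_cmp_eq hcmp, terms_oadd, terms_oadd, PNat.add_coe, Multiset.replicate_add]
      abel
    · rw [terms_oadd]

@[simp] theorem terms_natSum : ∀ a b, terms (natSum a b) = terms a + terms b
  | zero, b => by simp [natSum]
  | oadd e c a, b => by rw [natSum, terms_insertTerm, terms_natSum a b, terms_oadd, add_assoc]

theorem terms_natMul (a : ONote) : ∀ m, terms (natMul a m) = m • terms a
  | 0 => by simp [natMul]
  | m + 1 => by rw [natMul, terms_natSum, terms_natMul a m, succ_nsmul']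

@[simp] theorem terms_shift (t : ONote) : ∀ a, terms (shift t a) = (terms a).map (natSum t)
  | zero => by simp [shift]
  | oadd e c a => by
    rw [shift, terms_insertTerm, terms_shift t a, terms_oadd, Multiset.map_add,
      Multiset.map_replicate]

theorem NFBelow.nf {a : ONote} {b : Ordinal} (h : NFBelow a b) : NF a := ⟨b, h⟩

theorem NFBelow.mem_terms {a : ONote} {b : Ordinal} (h : NFBelow a b) {e : ONote}
    (he : e ∈ terms a) : NF e ∧ repr e < b := by
  induction a generalizing b with
  | zero => simp at he
  | oadd f c a _ ih =>
    rw [terms_oadd, Multiset.mem_add] at he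
    rcases he with he | he
    · rw [Multiset.eq_of_mem_replicate he]
      exact ⟨h.fst, h.lt⟩
    · exact ih (h.snd.mono h.lt.le) he

theorem NF.mem_terms {a e : ONote} (h : NF a) (he : e ∈ terms a) : NF e :=
  (h.out.choose_spec.mem_terms he).1

theorem head_mem_terms (e : ONote) (c : ℕ+) (a : ONote) : e ∈ terms (oadd e c a) := by
  simp [Multiset.mem_replicate]

theorem NF.notMem_terms {e a : ONote} {c : ℕ+} (h : NF (ONote.oadd e c a)) : e ∉ terms a :=
  fun he => (h.snd'.mem_terms he).2.false

/-- A normal form is determined by its multiset of exponents. -/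
theorem terms_inj : ∀ {a b : ONote}, NF a → NF b → terms a = terms b → a = b
  | zero, zero, _, _, _ => rfl
  | zero, oadd e c a, _, _, h => by
    have := head_mem_terms e c a
    rw [← h] at this
    simp at this
  | oadd e c a, zero, _, _, h => by
    have := head_mem_terms e c a
    rw [h] at this
    simp at this
  | oadd e c a, oadd f d b, ha, hb, h => by
    have le_head : ∀ {x y : ONote} {m : ℕ+}, NF (oadd x m y) → ∀ z ∈ terms (oadd x m y), z ≤ x := by
      intro x y m hx z hz
      rw [terms_oadd, Multiset.mem_add] at hz
      rcases hz with hz | hz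
      · rw [Multiset.eq_of_mem_replicate hz]
      · exact (hx.snd'.mem_terms hz).2.le
    have h1 := le_head hb e (h ▸ head_mem_terms e c a)
    have h2 := le_head ha f (h ▸ head_mem_terms f d b)
    have := ha.fst
    have := hb.fst
    obtain rfl : e = f := repr_inj.1 (le_antisymm h1 h2)
    have hc : (c : ℕ) = d := by
      have := congrArg (Multiset.count e) h
      rwa [terms_oadd, terms_oadd, Multiset.count_add, Multiset.count_add,
        Multiset.count_eq_zero_of_notMem ha.notMem_terms,
        Multiset.count_eq_zero_of_notMem hb.notMem_terms, Multiset.count_replicate_self,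
        Multiset.count_replicate_self] at this
    obtain rfl : c = d := PNat.coe_injective hc
    rw [terms_oadd, terms_oadd, add_right_inj] at h
    rw [terms_inj ha.snd hb.snd h]

theorem insertTerm_nf {f x : ONote} {m : ℕ+} (hf : NF f) (hx : NF x) : NF (insertTerm f m x) := by
  obtain ⟨b, hb⟩ := hx
  exact ⟨_, insertTerm_below hf (lt_max_of_lt_left (Order.lt_succ (repr f)))
    (hb.mono (le_max_right _ _))⟩

theorem natMul_nf {a : ONote} (h : NF a) (m : ℕ) : NF (natMul a m) :=
  (natMul_below (nfBelow_self h) m).nf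

theorem consTerm_nf {e : ONote} (h : NF e) (c : ℕ) : NF (consTerm e c 0) :=
  (consTerm_below h (Order.lt_succ _)).nf

theorem expDeriv_nf (n : ℕ) {b : ONote} (h : NF b) : NF (expDeriv n b) := (expDeriv_below n h).nf

/-- The normal form with a given multiset of exponents. -/
noncomputable def ofTerms (s : Multiset ONote) : ONote :=
  s.toList.foldr (fun e a => insertTerm e 1 a) 0

@[simp] theorem terms_ofTerms (s : Multiset ONote) : terms (ofTerms s) = s := by
  have : ∀ l : List ONote, terms (l.foldr (fun e a => insertTerm e 1 a) 0) = l := by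
    intro l
    induction l with
    | nil => rfl
    | cons e l ih => simp [ih]
  rw [ofTerms, this, Multiset.coe_toList]

theorem ofTerms_nf {s : Multiset ONote} (h : ∀ e ∈ s, NF e) : NF (ofTerms s) := by
  have : ∀ l : List ONote, (∀ e ∈ l, NF e) → NF (l.foldr (fun e a => insertTerm e 1 a) 0) := by
    intro l hl
    induction l with
    | nil => exact NF.zero
    | cons e l ih =>
      exact insertTerm_nf (hl e (by simp)) (ih fun x hx => hl x (by simp [hx]))
  exact this _ (by simpa using h)

/-- The ordinal obtained from `α` by removing one summand `ω ^ e`. -/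
noncomputable def eraseTerm (a e : ONote) : ONote := ofTerms ((terms a).erase e)

@[simp] theorem terms_eraseTerm (a e : ONote) : terms (eraseTerm a e) = (terms a).erase e :=
  terms_ofTerms _

theorem eraseTerm_nf {a : ONote} (h : NF a) (e : ONote) : NF (eraseTerm a e) :=
  ofTerms_nf fun _ hx => h.mem_terms (Multiset.mem_of_mem_erase hx)

/-- What replaces the summand `ω ^ γ` of `β` in the corresponding exponent of `Dₙ(ω ^ β)`. -/
def termDeriv (n : ℕ) (γ : ONote) : ONote := natSum (natMul γ (n - 1)) (expDeriv n γ)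

theorem termDeriv_below (n : ℕ) {γ : ONote} (h : NF γ) : NFBelow (termDeriv n γ) (repr γ) :=
  natSum_below (natMul_below (nfBelow_self h) _) (expDeriv_below n h)

/-- The exponent of `Dₙ(ω ^ β)` that comes from the summand `ω ^ γ` of `β`. -/
noncomputable def derivExponent (n : ℕ) (β γ : ONote) : ONote :=
  natSum (eraseTerm β γ) (termDeriv n γ)

theorem derivExponent_nf (n : ℕ) {β γ : ONote} (h : NF β) (hγ : NF γ) :
    NF (derivExponent n β γ) :=
  natSum_nf (eraseTerm_nf h γ) (termDeriv_below n hγ).nf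

@[simp] theorem terms_derivExponent (n : ℕ) (β γ : ONote) :
    terms (derivExponent n β γ) = (terms β).erase γ + terms (termDeriv n γ) := by
  simp [derivExponent]

theorem replicate_erase {e : ONote} (c : ℕ+) (s : Multiset ONote) :
    (Multiset.replicate c e + s).erase e = Multiset.replicate (c - 1 : ℕ) e + s := by
  obtain ⟨m, hm⟩ : ∃ m : ℕ, (c : ℕ) = m + 1 := ⟨c - 1, by have := c.pos; omega⟩
  rw [hm, Multiset.replicate_succ, Multiset.cons_add, Multiset.erase_cons_head]
  rfl

/-- The formula defining `Dₙ(ω ^ β)`, free of any choice of an order on the summands. -/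
theorem terms_expDeriv (n : ℕ) : ∀ {β : ONote}, NF β →
    terms (expDeriv n β) =
      (terms β).bind fun γ => Multiset.replicate n (derivExponent n β γ)
  | zero, _ => by simp [expDeriv]
  | oadd γ c b, h => by
    have hγ := h.fst
    have h0 : NF (oadd γ c 0) := NF.oadd_zero _ _
    rw [expDeriv, terms_natSum, terms_consTerm, terms_shift, terms_expDeriv n h.snd, terms_oadd,
      Multiset.add_bind]
    simp only [terms_zero, add_zero]
    congr 1
    · have key : natSum (consTerm γ (c - 1) 0)
          (natSum b (natSum (natMul γ (n - 1)) (expDeriv n γ))) =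
          derivExponent n (oadd γ c b) γ := by
        apply terms_inj
        · exact natSum_nf (consTerm_nf hγ _) (natSum_nf h.snd (termDeriv_below n hγ).nf)
        · exact derivExponent_nf n h hγ
        · rw [terms_derivExponent, terms_oadd, replicate_erase, ← termDeriv]
          simp [add_assoc]
      rw [key]
      have hbind : ∀ (m : ℕ) (f : ONote → Multiset ONote),
          (Multiset.replicate m γ).bind f = m • f γ := by
        intro m f
        simp [Multiset.bind, Multiset.join]
      rw [hbind, Multiset.nsmul_replicate]
    · rw [Multiset.map_bind]
      apply Multiset.bind_congr
      intro x hx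
      rw [Multiset.map_replicate]
      congr 1
      have hxn := h.snd.mem_terms hx
      apply terms_inj (natSum_nf h0 (derivExponent_nf n h.snd hxn)) (derivExponent_nf n h hxn)
      rw [terms_natSum, terms_derivExponent, terms_derivExponent, terms_oadd, terms_oadd,
        Multiset.erase_add_right_pos _ hx]
      simp [add_assoc]

/-- Leibniz rule for `β ↦ Dₙ(ω ^ β)`. -/
theorem terms_expDeriv_natSum (n : ℕ) {β γ : ONote} (hβ : NF β) (hγ : NF γ) :
    terms (expDeriv n (natSum β γ)) =
      (terms (expDeriv n β)).map (natSum γ) + (terms (expDeriv n γ)).map (natSum β) := by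
  have h := natSum_nf hβ hγ
  rw [terms_expDeriv n h, terms_expDeriv n hβ, terms_expDeriv n hγ, terms_natSum,
    Multiset.add_bind, Multiset.map_bind, Multiset.map_bind]
  congr 1
  all_goals
    apply Multiset.bind_congr
    intro x hx
    rw [Multiset.map_replicate]
    congr 1
  · have hxn := hβ.mem_terms hx
    apply terms_inj (derivExponent_nf n h hxn) (natSum_nf hγ (derivExponent_nf n hβ hxn))
    rw [terms_natSum, terms_derivExponent, terms_derivExponent, terms_natSum,
      Multiset.erase_add_left_pos _ hx]
    abel
  · have hxn := hγ.mem_terms hx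
    apply terms_inj (derivExponent_nf n h hxn) (natSum_nf hβ (derivExponent_nf n hγ hxn))
    rw [terms_natSum, terms_derivExponent, terms_derivExponent, terms_natSum,
      Multiset.erase_add_right_pos _ hx]
    abel

theorem mem_derivList (n : ℕ) : ∀ {α : ONote}, NF α → ∀ {x : ONote},
    (x ∈ derivList n α ↔ ∃ e ∈ terms α, x = natSum (eraseTerm α e) (expDeriv n e))
  | zero, _, x => by simp [derivList]
  | oadd e c a, h, x => by
    have he := h.fst
    have h0 : NF (oadd e c 0) := NF.oadd_zero _ _
    have hhead : natSum (consTerm e (c - 1) 0) (natSum a (expDeriv n e)) =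
        natSum (eraseTerm (oadd e c a) e) (expDeriv n e) := by
      apply terms_inj (natSum_nf (consTerm_nf he _) (natSum_nf h.snd (expDeriv_nf n he)))
        (natSum_nf (eraseTerm_nf h e) (expDeriv_nf n he))
      simp only [terms_natSum, terms_consTerm, terms_eraseTerm, terms_oadd, replicate_erase,
        terms_zero, add_zero, add_assoc]
    have htail : ∀ f ∈ terms a, natSum (oadd e c 0) (natSum (eraseTerm a f) (expDeriv n f)) =
        natSum (eraseTerm (oadd e c a) f) (expDeriv n f) := by
      intro f hf
      have hfn := h.snd.mem_terms hf
      apply terms_inj (natSum_nf h0 (natSum_nf (eraseTerm_nf h.snd f) (expDeriv_nf n hfn)))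
        (natSum_nf (eraseTerm_nf h f) (expDeriv_nf n hfn))
      simp only [terms_natSum, terms_eraseTerm, terms_oadd, terms_zero, add_zero, add_assoc,
        Multiset.erase_add_right_pos _ hf]
    rw [derivList, List.mem_cons, List.mem_map, hhead]
    constructor
    · rintro (rfl | ⟨y, hy, rfl⟩)
      · exact ⟨e, head_mem_terms e c a, rfl⟩
      · obtain ⟨f, hf, rfl⟩ := (mem_derivList n h.snd).1 hy
        exact ⟨f, by simp [hf], htail f hf⟩
    · rintro ⟨f, hf, rfl⟩
      rw [terms_oadd, Multiset.mem_add] at hf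
      rcases hf with hf | hf
      · rw [Multiset.eq_of_mem_replicate hf]
        exact Or.inl rfl
      · exact Or.inr ⟨_, (mem_derivList n h.snd).2 ⟨f, hf, rfl⟩, htail f hf⟩

end ONote

theorem NONote.mem_deriv {n : ℕ} {α β : NONote} :
    β ∈ NONote.deriv n α ↔ β.1 ∈ ONote.derivList n α.1 := by
  constructor
  · intro h
    obtain ⟨x, -, rfl⟩ := List.mem_map.1 h
    exact x.2
  · intro h
    exact List.mem_map.2 ⟨⟨β.1, h⟩, List.mem_attach _ _, rfl⟩

/-! ### Leanness of derivatives -/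

namespace ONote

theorem IsLean.mono {ℓ m : ℕ} (hm : ℓ ≤ m) : ∀ {a : ONote}, IsLean ℓ a → IsLean m a
  | zero, _ => trivial
  | oadd _ _ _, h => ⟨h.1.mono hm, h.2.1.trans hm, h.2.2.mono hm⟩

/-- The coefficients of a normal form are the multiplicities of its exponents. -/
theorem isLean_iff {ℓ : ℕ} : ∀ {a : ONote}, NF a →
    (IsLean ℓ a ↔ ∀ e ∈ terms a, IsLean ℓ e ∧ (terms a).count e ≤ ℓ)
  | zero, _ => by simp [IsLean]
  | oadd e c a, h => by
    have hcount : (terms (oadd e c a)).count e = c := by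
      rw [terms_oadd, Multiset.count_add, Multiset.count_replicate_self,
        Multiset.count_eq_zero_of_notMem h.notMem_terms, add_zero]
    have hcount' : ∀ f ∈ terms a, (terms (oadd e c a)).count f = (terms a).count f := by
      intro f hf
      have hne : f ≠ e := by
        rintro rfl
        exact h.notMem_terms hf
      rw [terms_oadd, Multiset.count_add, Multiset.count_replicate, if_neg hne.symm,
        _root_.zero_add]
    rw [IsLean, isLean_iff h.snd]
    constructor
    · rintro ⟨h1, h2, h3⟩ f hf
      rw [terms_oadd, Multiset.mem_add] at hf
      rcases hf with hf | hf
      · rw [Multiset.eq_of_mem_replicate hf, hcount]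
        exact ⟨h1, h2⟩
      · rw [hcount' f hf]
        exact h3 f hf
    · intro H
      have he := H e (head_mem_terms e c a)
      rw [hcount] at he
      refine ⟨he.1, he.2, fun f hf => ?_⟩
      have := H f (by simp [hf])
      rwa [hcount' f hf] at this

theorem IsLean.of_terms_le {ℓ : ℕ} {a b : ONote} (ha : NF a) (hb : NF b) (h : IsLean ℓ b)
    (hab : terms a ≤ terms b) : IsLean ℓ a := by
  rw [isLean_iff hb] at h
  rw [isLean_iff ha]
  intro e he
  have := h e (Multiset.mem_of_le hab he)
  exact ⟨this.1, (Multiset.count_le_of_le e hab).trans this.2⟩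

theorem IsLean.natSum {p q : ℕ} {a b : ONote} (hna : NF a) (hnb : NF b) (ha : IsLean p a)
    (hb : IsLean q b) : IsLean (p + q) (natSum a b) := by
  rw [isLean_iff hna] at ha
  rw [isLean_iff hnb] at hb
  rw [isLean_iff (natSum_nf hna hnb), terms_natSum]
  intro e he
  rw [Multiset.count_add]
  have hca : (terms a).count e ≤ p := by
    by_cases h : e ∈ terms a
    · exact (ha e h).2
    · simp [Multiset.count_eq_zero_of_notMem h]
  have hcb : (terms b).count e ≤ q := by
    by_cases h : e ∈ terms b
    · exact (hb e h).2
    · simp [Multiset.count_eq_zero_of_notMem h]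
  refine ⟨?_, add_le_add hca hcb⟩
  rcases Multiset.mem_add.1 he with h | h
  · exact (ha e h).1.mono (Nat.le_add_right _ _)
  · exact (hb e h).1.mono (Nat.le_add_left _ _)

theorem IsLean.natMul {ℓ : ℕ} {a : ONote} (hna : NF a) (ha : IsLean ℓ a) :
    ∀ m, IsLean (ℓ * m) (natMul a m)
  | 0 => trivial
  | m + 1 => by
    rw [Nat.mul_succ, Nat.add_comm]
    exact ha.natSum hna (natMul_nf hna m) (IsLean.natMul hna ha m)

theorem IsLean.eraseTerm {ℓ : ℕ} {a : ONote} (hna : NF a) (ha : IsLean ℓ a) (e : ONote) :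
    IsLean ℓ (eraseTerm a e) :=
  ha.of_terms_le (eraseTerm_nf hna e) hna (by simpa using Multiset.erase_le e (terms a))

theorem lt_towerNote_succ {a : ONote} {k : ℕ} (ha : NF a) :
    a < towerNote (k + 1) ↔ NFBelow a (repr (towerNote k)) := by
  have h : repr (towerNote (k + 1)) = Ordinal.omega0 ^ repr (towerNote k) := by
    simp [towerNote, repr]
  rw [lt_def, h]
  exact ⟨fun h => NF.below_of_lt' h ha, fun h => h.repr_lt⟩

theorem lt_towerNote_zero {a : ONote} : a < towerNote 0 ↔ a = 0 := by
  rw [lt_def, show repr (towerNote 0) = 1 from by simp [towerNote], Order.lt_one_iff]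
  constructor
  · intro h
    cases a with
    | zero => rfl
    | oadd e c a => exact absurd h (lt_def.1 (oadd_pos e c a)).ne'
  · rintro rfl
    rfl

theorem oadd_lt_towerNote_succ {b : ONote} {k : ℕ} (hb : NF b) :
    oadd b 1 0 < towerNote (k + 1) ↔ b < towerNote k := by
  rw [lt_towerNote_succ (NF.oadd_zero _ _)]
  exact ⟨fun h => h.lt, fun h => NFBelow.oadd hb NFBelow.zero h⟩

theorem lt_towerNote_of_mem_terms {a e : ONote} {k : ℕ} (ha : NF a) (h : a < towerNote (k + 1))
    (he : e ∈ terms a) : e < towerNote k :=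
  (((lt_towerNote_succ ha).1 h).mem_terms he).2

theorem count_derivExponent_of_le (n : ℕ) {β γ δ : ONote} (hγ : NF γ) (h : γ ≤ δ) :
    (terms (derivExponent n β γ)).count δ = ((terms β).erase γ).count δ := by
  rw [terms_derivExponent, Multiset.count_add, Multiset.count_eq_zero_of_notMem (a := δ)
    (s := terms (termDeriv n γ)), add_zero]
  intro hδ
  exact (((termDeriv_below n hγ).mem_terms hδ).2.trans_le h).false

/-- Different summands of `β` contribute different exponents to `Dₙ(ω ^ β)`: the number of
occurrences of the larger summand tells them apart. -/
theorem derivExponent_inj (n : ℕ) {β γ δ : ONote} (hβ : NF β) (hγ : γ ∈ terms β)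
    (hδ : δ ∈ terms β) (h : derivExponent n β γ = derivExponent n β δ) : γ = δ := by
  by_contra hne
  wlog hle : γ ≤ δ generalizing γ δ
  · exact this hδ hγ h.symm (Ne.symm hne) ((le_total (repr γ) (repr δ)).resolve_left hle)
  have h1 := count_derivExponent_of_le n (β := β) (hβ.mem_terms hγ) hle
  have h2 := count_derivExponent_of_le n (β := β) (hβ.mem_terms hδ) (le_refl δ)
  rw [h, h2, Multiset.count_erase_self, Multiset.count_erase_of_ne (Ne.symm hne)] at h1
  have := Multiset.count_pos.2 hδ
  omega

theorem expDeriv_zero_left {β : ONote} (h : NF β) : expDeriv 0 β = 0 :=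
  terms_inj (expDeriv_nf 0 h) NF.zero (by simp [terms_expDeriv 0 h])

theorem count_expDeriv_le (n : ℕ) {β γ : ONote} (hβ : NF β) (hγ : γ ∈ terms β) :
    (terms (expDeriv n β)).count (derivExponent n β γ) ≤ (terms β).count γ * n := by
  rw [terms_expDeriv n hβ, Multiset.count_bind]
  have hsum : ∀ s : Multiset ONote, s ≤ terms β → (s.map fun δ =>
      (Multiset.replicate n (derivExponent n β δ)).count (derivExponent n β γ)).sum ≤
      s.count γ * n := by
    intro s
    induction s using Multiset.induction with
    | empty => simp
    | cons δ s ih =>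
      intro hs
      have ih' := ih ((Multiset.le_cons_self s δ).trans hs)
      rw [Multiset.map_cons, Multiset.sum_cons, Multiset.count_replicate, Multiset.count_cons,
        add_mul, add_comm (_ * n)]
      refine add_le_add ?_ ih'
      by_cases hE : derivExponent n β δ = derivExponent n β γ
      · rw [derivExponent_inj n hβ (Multiset.mem_of_le hs (Multiset.mem_cons_self δ s)) hγ hE]
        simp
      · simp [hE]
  exact hsum _ le_rfl

/-- In an exponent of `Dₙ(ω ^ β)`, the remaining summands of `β` contribute at most `ℓ` to each
coefficient, the copies of `γ` at most `ℓ * (n - 1)`, and `Dₙ(ω ^ γ)` at most `ℓ * n * (k - 1)` by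
induction. -/
theorem IsLean.expDeriv {ℓ : ℕ} (n : ℕ) : ∀ {k : ℕ} {β : ONote}, NF β → β < towerNote k →
    IsLean ℓ β → IsLean (ℓ * n * k) (expDeriv n β)
  | 0, β, _, hk, _ => by
    rw [lt_towerNote_zero.1 hk]
    trivial
  | k + 1, β, hβ, hk, hℓ => by
    -- for `n = 0` the factor `n - 1` is truncated, but then `Dₙ` vanishes
    rcases Nat.eq_zero_or_pos n with rfl | hn
    · rw [expDeriv_zero_left hβ]
      trivial
    rw [isLean_iff (expDeriv_nf n hβ)]
    intro e he
    rw [terms_expDeriv n hβ, Multiset.mem_bind] at he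
    obtain ⟨γ, hγ, he⟩ := he
    obtain rfl := Multiset.eq_of_mem_replicate he
    have hγn := hβ.mem_terms hγ
    have hγℓ := (isLean_iff hβ).1 hℓ γ hγ
    constructor
    · have h1 := IsLean.expDeriv n hγn (lt_towerNote_of_mem_terms hβ hk hγ) hγℓ.1
      have h2 := (hγℓ.1.natMul hγn (n - 1)).natSum (natMul_nf hγn _) (expDeriv_nf n hγn) h1
      have h3 := (hℓ.eraseTerm hβ γ).natSum (eraseTerm_nf hβ γ) (termDeriv_below n hγn).nf h2
      have harith : ℓ * n * (k + 1) = ℓ + (ℓ * (n - 1) + ℓ * n * k) := by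
        obtain ⟨m, rfl⟩ : ∃ m, n = m + 1 := ⟨n - 1, by omega⟩
        rw [Nat.add_sub_cancel]
        ring
      rw [harith]
      exact h3
    · calc _ ≤ (terms β).count γ * n := count_expDeriv_le n hβ hγ
        _ ≤ ℓ * n := Nat.mul_le_mul_right _ hγℓ.2
        _ ≤ ℓ * n * (k + 1) := Nat.le_mul_of_pos_right _ (Nat.succ_pos k)

theorem IsLean.derivList {ℓ n k : ℕ} {α x : ONote} (hα : NF α) (hk : α < towerNote (k + 1))
    (hℓ : IsLean ℓ α) (hx : x ∈ derivList n α) : IsLean (ℓ + ℓ * n * k) x := by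
  obtain ⟨e, he, rfl⟩ := (mem_derivList n hα).1 hx
  have hen := hα.mem_terms he
  exact (hℓ.eraseTerm hα e).natSum (eraseTerm_nf hα e) (expDeriv_nf n hen)
    (IsLean.expDeriv n hen (lt_towerNote_of_mem_terms hα hk he) ((isLean_iff hα).1 hℓ e he).1)

end ONote

/-! ### Order types -/

namespace NestedMultiset

open ONote in
theorem orderType_below : ∀ (A : NestedMultiset) (k : ℕ), A.depth ≤ k + 1 →
    NFBelow A.orderType.1 (repr (towerNote k))
  | empty, _, _ => NFBelow.zero
  | sum A B, k, h =>
    natSum_below (orderType_below A k ((le_max_left _ _).trans h))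
      (orderType_below B k ((le_max_right _ _).trans h))
  | mset A, k, h => by
    refine NFBelow.oadd A.orderType.2 NFBelow.zero ?_
    have hA : A.depth ≤ k := Nat.le_of_succ_le_succ h
    rw [← lt_def]
    cases k with
    | succ k => exact (lt_towerNote_succ A.orderType.2).2 (orderType_below A k hA)
    | zero =>
      rw [lt_towerNote_zero]
      clear h
      induction A with
      | empty => rfl
      | sum A B ihA ihB =>
        have h1 := ihA ((le_max_left _ _).trans hA)
        have h2 := ihB ((le_max_right _ _).trans hA)
        simp only [orderType, h1, h2]
        rfl
      | mset A => exact absurd hA (Nat.not_succ_le_zero _)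

theorem orderType_lt_tower {A : NestedMultiset} {k : ℕ} (h : A.depth ≤ k + 1) :
    A.orderType < NONote.tower (k + 1) :=
  (ONote.lt_towerNote_succ A.orderType.2).2 (orderType_below A k h)

theorem terms_orderType_copies (A : NestedMultiset) : ∀ m,
    ONote.terms (copies A m).orderType.1 = m • ONote.terms A.orderType.1
  | 0 => by simp [copies, orderType]; rfl
  | m + 1 => by
    rw [copies, orderType, ONote.terms_natSum, terms_orderType_copies A m, succ_nsmul']

theorem orderType_canon : ∀ {a : ONote}, ONote.NF a → (canon a).orderType.1 = a
  | ONote.zero, _ => rfl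
  | ONote.oadd e c a, h => by
    apply ONote.terms_inj (canon _).orderType.2 h
    have hm : ONote.terms (mset (canon e)).orderType.1 = {e} := by
      have he : (mset (canon e)).orderType.1 = ONote.oadd (canon e).orderType.1 1 0 := rfl
      rw [he, orderType_canon h.fst]
      simp
    rw [canon, orderType, ONote.terms_natSum, terms_orderType_copies, orderType_canon h.snd, hm,
      ONote.terms_oadd, Multiset.nsmul_singleton]

end NestedMultiset

/-! ### Descent along fundamental sequences -/

namespace ONote

theorem isSucc_oadd_zero (e : ONote) (c : ℕ+) : isSucc (oadd e c 0) = decide (e = 0) := by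
  simp [isSucc]

theorem isSucc_oadd {a : ONote} (ha : a ≠ 0) (e : ONote) (c : ℕ+) :
    isSucc (oadd e c a) = isSucc a := by
  simp [isSucc, ha]

theorem ne_zero_of_isSucc {a : ONote} (h : isSucc a = true) : a ≠ 0 := by
  rintro rfl
  exact absurd h (by decide)

theorem fundSeq_oadd {a : ONote} (ha : a ≠ 0) (e : ONote) (c : ℕ+) (x : ℕ) :
    fundSeq (oadd e c a) x = oadd e c (fundSeq a x) := by
  simp [fundSeq, ha]

theorem consTerm_succ (e : ONote) (c : ℕ) (t : ONote) :
    consTerm e (c + 1) t = oadd e c.succPNat t := by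
  simp [consTerm, Nat.succPNat]

@[simp] theorem consTerm_zero (e t : ONote) : consTerm e 0 t = t := by
  simp [consTerm]

theorem consTerm_one (e t : ONote) : consTerm e 1 t = oadd e 1 t := consTerm_succ e 0 t

theorem fundSeq_oadd_zero (e : ONote) (c : ℕ+) (x : ℕ) :
    fundSeq (oadd e c 0) x = consTerm e (c - 1) (fundSeq (oadd e 1 0) x) := by
  simp [fundSeq]

theorem fundSeq_one (x : ℕ) : fundSeq (oadd 0 1 0) x = 0 := by
  simp [fundSeq]

theorem fundSeq_opow_succ {e : ONote} (h : isSucc e = true) (x : ℕ) :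
    fundSeq (oadd e 1 0) x = consTerm (fundSeq e x) x 0 := by
  simp [fundSeq, h, ne_zero_of_isSucc h]

theorem fundSeq_opow_limit {e : ONote} (h0 : e ≠ 0) (h : isSucc e = false) (x : ℕ) :
    fundSeq (oadd e 1 0) x = oadd (fundSeq e x) 1 0 := by
  simp [fundSeq, h, h0, consTerm_one]

@[simp] theorem fundSeq_zero (x : ℕ) : fundSeq 0 x = 0 := rfl

theorem fundSeq_congr_of_isSucc : ∀ {a : ONote}, isSucc a = true → ∀ x y,
    fundSeq a x = fundSeq a y
  | oadd e c a, h, x, y => by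
    by_cases ha : a = 0
    · subst ha
      rw [isSucc_oadd_zero, decide_eq_true_eq] at h
      simp [fundSeq, h]
    · rw [isSucc_oadd ha] at h
      rw [fundSeq_oadd ha, fundSeq_oadd ha, fundSeq_congr_of_isSucc h x y]

theorem consTerm_below' {e t : ONote} {c : ℕ} {b : Ordinal} (he : NF e) (hb : repr e < b)
    (ht : NFBelow t (repr e)) : NFBelow (consTerm e c t) b := by
  unfold consTerm
  split_ifs
  · exact NFBelow.oadd he ht hb
  · exact ht.mono hb.le

theorem fundSeq_below : ∀ {a : ONote} {b : Ordinal} (x : ℕ), NFBelow a b → NFBelow (fundSeq a x) b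
  | zero, _, _, _ => NFBelow.zero
  | oadd e c a, b, x, h => by
    by_cases ha : a = 0
    · subst ha
      have hlt := fundSeq_lt e x
      rw [fundSeq, if_pos rfl]
      refine consTerm_below' h.fst h.lt ?_
      split_ifs with h1 h2
      · exact NFBelow.zero
      · exact consTerm_below (fundSeq_below x (nfBelow_self h.fst)).nf (hlt h1)
      · exact consTerm_below (fundSeq_below x (nfBelow_self h.fst)).nf (hlt h1)
    · rw [fundSeq_oadd ha]
      exact NFBelow.oadd h.fst (fundSeq_below x h.snd) h.lt

theorem fundSeq_nf {a : ONote} (h : NF a) (x : ℕ) : NF (fundSeq a x) :=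
  (fundSeq_below x (nfBelow_self h)).nf

theorem consTerm_ne_zero {e : ONote} {c : ℕ} {t : ONote} (h : c ≠ 0 ∨ t ≠ 0) :
    consTerm e c t ≠ 0 := by
  unfold consTerm
  split_ifs with hc
  · exact nofun
  · exact h.resolve_left (by omega)

theorem fundSeq_ne_zero {a : ONote} (h0 : a ≠ 0) (h : isSucc a = false) {x : ℕ} (hx : 1 ≤ x) :
    fundSeq a x ≠ 0 := by
  obtain _ | ⟨e, c, a⟩ := a
  · exact absurd rfl h0
  by_cases ha : a = 0
  · subst ha
    rw [isSucc_oadd_zero, decide_eq_false_iff_not] at h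
    rw [fundSeq_oadd_zero]
    apply consTerm_ne_zero
    right
    cases hs : isSucc e
    · rw [fundSeq_opow_limit h hs]
      exact nofun
    · rw [fundSeq_opow_succ hs]
      exact consTerm_ne_zero (Or.inl (by omega))
  · rw [fundSeq_oadd ha]
    exact nofun

/-- `Descends x α β`: the ordinal `β` is reached from `α` by repeatedly taking the `x`-th element
of the fundamental sequence (the predecessor, at successors). -/
def Descends (x : ℕ) : ONote → ONote → Prop :=
  Relation.ReflTransGen fun a b => b = fundSeq a x

namespace Descends

theorem refl (x : ℕ) (a : ONote) : Descends x a a := Relation.ReflTransGen.refl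

theorem trans {x : ℕ} {a b c : ONote} (h : Descends x a b) (h' : Descends x b c) :
    Descends x a c := Relation.ReflTransGen.trans h h'

theorem step (x : ℕ) (a : ONote) : Descends x a (fundSeq a x) := Relation.ReflTransGen.single rfl

theorem head {x : ℕ} {a b : ONote} (h : Descends x (fundSeq a x) b) : Descends x a b :=
  (step x a).trans h

theorem eq_or_step {x : ℕ} {a b : ONote} (h : Descends x a b) :
    a = b ∨ Descends x (fundSeq a x) b := by
  rcases Relation.ReflTransGen.cases_head h with h | ⟨c, rfl, hc⟩
  · exact Or.inl h
  · exact Or.inr hc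

theorem map {x y : ℕ} {f : ONote → ONote} (hf : ∀ a, Descends y (f a) (f (fundSeq a x)))
    {a b : ONote} (h : Descends x a b) : Descends y (f a) (f b) := by
  induction h with
  | refl => exact refl _ _
  | tail _ hbc ih =>
    rw [hbc]
    exact ih.trans (hf _)

theorem zero (x : ℕ) (a : ONote) : Descends x a 0 := by
  by_cases h : a = 0
  · rw [h]
    exact refl x 0
  · have := fundSeq_lt a x h
    exact (zero x (fundSeq a x)).head
termination_by a

theorem oadd {x : ℕ} {a b : ONote} (h : Descends x a b) (e : ONote) (c : ℕ+) :
    Descends x (oadd e c a) (oadd e c b) := by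
  refine h.map (f := ONote.oadd e c) fun a => ?_
  by_cases ha : a = 0
  · subst ha
    exact refl _ _
  · rw [← fundSeq_oadd ha]
    exact step _ _

theorem consTerm {x : ℕ} {a b : ONote} (h : Descends x a b) (e : ONote) (c : ℕ) :
    Descends x (consTerm e c a) (consTerm e c b) := by
  cases c with
  | zero => simpa using h
  | succ c => simpa [consTerm_succ] using h.oadd e _

theorem consTerm_of_le {x : ℕ} (e : ONote) {c d : ℕ} (h : d ≤ c) :
    Descends x (ONote.consTerm e c 0) (ONote.consTerm e d 0) := by
  induction h with
  | refl => exact refl _ _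
  | step _ ih =>
    refine trans ?_ ih
    rw [consTerm_succ]
    apply head
    rw [fundSeq_oadd_zero]
    exact (zero x _).consTerm e _

theorem opow {x : ℕ} (hx : 1 ≤ x) {a b : ONote} (h : Descends x a b) :
    Descends x (ONote.oadd a 1 0) (ONote.oadd b 1 0) := by
  refine h.map (f := fun a => ONote.oadd a 1 0) fun a => ?_
  by_cases ha : a = 0
  · subst ha
    exact refl _ _
  · apply head
    cases hs : isSucc a
    · rw [fundSeq_opow_limit ha hs]
      exact refl _ _
    · rw [fundSeq_opow_succ hs, ← consTerm_one]
      exact consTerm_of_le _ hx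

/-- Bachmann property: `λ_x` lies on the descent path of index `y` that starts at `λ_y`. -/
theorem fundSeq_of_le {x y : ℕ} (hxy : x ≤ y) (hy : 1 ≤ y) : ∀ {a : ONote}, isSucc a = false →
    Descends y (fundSeq a y) (fundSeq a x)
  | ONote.zero, _ => refl _ _
  | ONote.oadd e c a, h => by
    by_cases ha : a = 0
    · subst ha
      rw [isSucc_oadd_zero, decide_eq_false_iff_not] at h
      rw [fundSeq_oadd_zero e c x, fundSeq_oadd_zero e c y]
      apply consTerm
      cases hs : isSucc e
      · rw [fundSeq_opow_limit h hs, fundSeq_opow_limit h hs]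
        exact (fundSeq_of_le hxy hy hs).opow hy
      · rw [fundSeq_opow_succ hs, fundSeq_opow_succ hs, fundSeq_congr_of_isSucc hs x y]
        exact consTerm_of_le _ hxy
    · rw [isSucc_oadd ha] at h
      rw [fundSeq_oadd ha, fundSeq_oadd ha]
      exact (fundSeq_of_le hxy hy h).oadd e c

end Descends

theorem pos_of_ne_zero {a : ONote} (h : a ≠ 0) : 0 < a := by
  cases a with
  | zero => exact absurd rfl h
  | oadd e c a => exact oadd_pos e c a

theorem lt_oadd_cases {f e b a : ONote} {d c : ℕ+} (hf : NF f) (he : NF e)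
    (ha : NF (oadd e c a)) (h : oadd f d b < oadd e c a) :
    f < e ∨ f = e ∧ ((d : ℕ) < c ∨ d = c ∧ b < a) := by
  have := hf
  have := he
  rcases lt_trichotomy (repr f) (repr e) with h1 | h1 | h1
  · exact Or.inl h1
  · obtain rfl := repr_inj.1 h1
    refine Or.inr ⟨rfl, ?_⟩
    rcases lt_trichotomy (d : ℕ) c with h2 | h2 | h2
    · exact Or.inl h2
    · obtain rfl := PNat.coe_injective h2
      refine Or.inr ⟨rfl, ?_⟩
      rw [lt_def] at h ⊢
      simpa [repr] using h
    · exact absurd h (oadd_lt_oadd_2 ha h2).asymm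
  · exact absurd h (oadd_lt_oadd_1 ha h1).asymm

theorem lt_oadd_one {f e b : ONote} {d : ℕ+} (hb : NF (oadd f d b)) (h : f < e) (c : ℕ+)
    (a : ONote) : oadd f d b < oadd e c a :=
  oadd_lt_oadd_1 hb h

/-- An ordinal below a limit `λ` whose coefficients are all smaller than `x` is below `λ_x`. -/
theorem lt_fundSeq_of_isLean {z x : ℕ} (hz : z < x) : ∀ {a u : ONote}, NF a → a ≠ 0 →
    isSucc a = false → NF u → u < a → IsLean z u → u < fundSeq a x
  | zero, _, _, h0, _, _, _, _ => absurd rfl h0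
  | oadd e c a, zero, _, h0, hs, _, _, _ =>
    pos_of_ne_zero (fundSeq_ne_zero h0 hs (by omega))
  | oadd e c a, oadd f d b, ha, _, hs, hu, hua, hl => by
    have hx : 1 ≤ x := by omega
    have he := ha.fst
    have hf := hu.fst
    by_cases h0 : a = 0
    · subst h0
      rw [isSucc_oadd_zero, decide_eq_false_iff_not] at hs
      -- ordinals below `ω ^ e`
      have key : ∀ {f b : ONote} {d : ℕ+}, NF (oadd f d b) → f < e → IsLean z (oadd f d b) →
          oadd f d b < fundSeq (oadd e 1 0) x := by
        intro f b d hu hfe hl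
        have hf := hu.fst
        cases hse : isSucc e
        · rw [fundSeq_opow_limit hs hse]
          exact lt_oadd_one hu (lt_fundSeq_of_isLean hz he hs hse hf hfe hl.1) _ _
        · rw [fundSeq_opow_succ hse]
          obtain ⟨x, rfl⟩ : ∃ x', x = x' + 1 := ⟨x - 1, by omega⟩
          have hle : repr f ≤ repr (fundSeq e (x + 1)) := by
            rw [← Order.lt_succ_iff, Order.succ_eq_add_one, ← isSucc_repr e (x + 1) hse]
            exact hfe
          have := fundSeq_nf he (x + 1)
          rw [consTerm_succ]
          rcases hle.lt_or_eq with hlt | heq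
          · exact lt_oadd_one hu hlt _ _
          · obtain rfl := repr_inj.1 heq
            exact oadd_lt_oadd_2 hu (lt_of_le_of_lt hl.2.1 (by rwa [Nat.succPNat_coe]))
      rw [fundSeq_oadd_zero]
      by_cases hc : (c : ℕ) - 1 = 0
      · rw [hc, consTerm_zero]
        rcases lt_oadd_cases hf he ha hua with h | ⟨rfl, h | ⟨-, h⟩⟩
        · exact key hu h hl
        · have := d.pos
          omega
        · exact absurd h (by rw [lt_def]; simp)
      · obtain ⟨c', hc'⟩ : ∃ c' : ℕ+, (c' : ℕ) = c - 1 := ⟨⟨c - 1, by omega⟩, rfl⟩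
        have hpre : ∀ t, consTerm e (c - 1) t = oadd e c' t := by
          intro t
          rw [← hc', consTerm, dif_pos c'.pos]
          rfl
        rw [hpre]
        rcases lt_oadd_cases hf he ha hua with h | ⟨rfl, h | ⟨-, h⟩⟩
        · exact lt_oadd_one hu h _ _
        · by_cases hd : (d : ℕ) = c - 1
          · obtain rfl : d = c' := PNat.coe_injective (hd.trans hc'.symm)
            apply oadd_lt_oadd_3
            obtain _ | ⟨f', d', b'⟩ := b
            · exact pos_of_ne_zero (fundSeq_ne_zero (a := oadd f 1 0) nofun
                (by rw [isSucc_oadd_zero, decide_eq_false_iff_not]; exact hs) hx)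
            · exact key hu.snd hu.snd'.lt hl.2.2
          · exact oadd_lt_oadd_2 hu (by omega)
        · exact absurd h (by rw [lt_def]; simp)
    · rw [isSucc_oadd h0] at hs
      rw [fundSeq_oadd h0]
      rcases lt_oadd_cases hf he ha hua with h | ⟨rfl, h | ⟨rfl, h⟩⟩
      · exact lt_oadd_one hu h _ _
      · exact oadd_lt_oadd_2 hu h
      · exact oadd_lt_oadd_3 (lt_fundSeq_of_isLean hz ha.snd h0 hs hu.snd h hl.2.2)

theorem le_fundSeq_of_isSucc {a u : ONote} (h : isSucc a = true) (hu : u < a) (x : ℕ) :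
    u ≤ fundSeq a x := by
  rw [le_def, ← Order.lt_succ_iff, Order.succ_eq_add_one, ← isSucc_repr a x h]
  exact hu

/-- The same bound on coefficients makes a smaller ordinal reachable by descent. -/
theorem Descends.of_isLean {z x : ℕ} (hz : z < x) {a u : ONote} (ha : NF a) (hu : NF u)
    (h : u ≤ a) (hl : IsLean z u) : Descends x a u := by
  rcases (le_def.1 h).lt_or_eq with hlt | heq
  · have h0 : a ≠ 0 := by
      rintro rfl
      simp at hlt
    have := fundSeq_lt a x h0
    apply Descends.head
    apply Descends.of_isLean hz (fundSeq_nf ha x) hu _ hl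
    cases hs : isSucc a
    · exact (lt_fundSeq_of_isLean hz ha h0 hs hu hlt hl).le
    · exact le_fundSeq_of_isSucc hs hlt x
  · rw [repr_inj.1 heq]
    exact Descends.refl _ _
termination_by a

/-- The predecessor of the first successor met on the descent path of index `x`. -/
def predAt (x : ℕ) (a : ONote) : ONote :=
  if h : a = 0 then 0
  else
    have := fundSeq_lt a x h
    if isSucc a then fundSeq a x else predAt x (fundSeq a x)
termination_by a

@[simp] theorem predAt_zero (x : ℕ) : predAt x 0 = 0 := by
  rw [predAt, dif_pos rfl]

theorem predAt_succ {a : ONote} (h : isSucc a = true) (x : ℕ) : predAt x a = fundSeq a x := by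
  rw [predAt, dif_neg (ne_zero_of_isSucc h), if_pos h]

theorem predAt_limit {a : ONote} (h : isSucc a = false) (x : ℕ) :
    predAt x a = predAt x (fundSeq a x) := by
  by_cases h0 : a = 0
  · rw [h0, fundSeq_zero]
  · rw [predAt, dif_neg h0, if_neg (by simp [h])]

theorem predAt_oadd {x : ℕ} (hx : 1 ≤ x) {a : ONote} (ha : a ≠ 0) (e : ONote) (c : ℕ+) :
    predAt x (oadd e c a) = oadd e c (predAt x a) := by
  have := fundSeq_lt a x ha
  cases hs : isSucc a
  · rw [predAt_limit ((isSucc_oadd ha e c).trans hs), fundSeq_oadd ha, predAt_limit hs,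
      predAt_oadd hx (fundSeq_ne_zero ha hs hx)]
  · rw [predAt_succ ((isSucc_oadd ha e c).trans hs), fundSeq_oadd ha, predAt_succ hs]
termination_by a

theorem predAt_consTerm {x : ℕ} (hx : 1 ≤ x) {a : ONote} (ha : a ≠ 0) (e : ONote) (c : ℕ) :
    predAt x (consTerm e c a) = consTerm e c (predAt x a) := by
  cases c with
  | zero => simp
  | succ c => rw [consTerm_succ, consTerm_succ, predAt_oadd hx ha]

theorem predAt_oadd_zero {x : ℕ} (hx : 1 ≤ x) (e : ONote) (c : ℕ+) :
    predAt x (oadd e c 0) = consTerm e (c - 1) (predAt x (oadd e 1 0)) := by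
  by_cases he : e = 0
  · subst he
    rw [predAt_succ (by simp [isSucc_oadd_zero]), predAt_succ (by simp [isSucc_oadd_zero]),
      fundSeq_oadd_zero]
  · rw [predAt_limit (by simp [isSucc_oadd_zero, he]), fundSeq_oadd_zero, predAt_consTerm hx,
      predAt_limit (a := oadd e 1 0) (by simp [isSucc_oadd_zero, he])]
    exact fundSeq_ne_zero (a := oadd e 1 0) nofun (by simp [isSucc_oadd_zero, he]) hx

theorem predAt_nf (x : ℕ) {a : ONote} (ha : NF a) : NF (predAt x a) := by
  by_cases h0 : a = 0
  · rw [h0, predAt_zero]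
    exact NF.zero
  · have := fundSeq_lt a x h0
    cases hs : isSucc a
    · rw [predAt_limit hs]
      exact predAt_nf x (fundSeq_nf ha x)
    · rw [predAt_succ hs]
      exact fundSeq_nf ha x
termination_by a

theorem le_predAt_of_isLean {z x : ℕ} (hz : z < x) {a u : ONote} (ha : NF a) (hu : NF u)
    (h : u < a) (hl : IsLean z u) : u ≤ predAt x a := by
  have h0 : a ≠ 0 := by
    rintro rfl
    simp [lt_def] at h
  have := fundSeq_lt a x h0
  cases hs : isSucc a
  · rw [predAt_limit hs]
    exact le_predAt_of_isLean hz (fundSeq_nf ha x) hu (lt_fundSeq_of_isLean hz ha h0 hs hu h hl) hl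
  · rw [predAt_succ hs]
    exact le_fundSeq_of_isSucc hs h x
termination_by a

theorem card_terms_of_isSucc : ∀ {a : ONote} (x : ℕ), isSucc a = true →
    (terms a).card = (terms (fundSeq a x)).card + 1
  | oadd e c a, x, h => by
    by_cases ha : a = 0
    · subst ha
      rw [isSucc_oadd_zero, decide_eq_true_eq] at h
      subst h
      rw [fundSeq_oadd_zero, fundSeq_one]
      have := c.pos
      simp
      omega
    · rw [isSucc_oadd ha] at h
      rw [fundSeq_oadd ha, terms_oadd, terms_oadd, Multiset.card_add, Multiset.card_add,
        card_terms_of_isSucc x h, add_assoc]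

theorem card_terms_le_fundSeq {x : ℕ} (hx : 1 ≤ x) : ∀ {a : ONote}, isSucc a = false →
    (terms a).card ≤ (terms (fundSeq a x)).card
  | zero, _ => by simp
  | oadd e c a, h => by
    by_cases ha : a = 0
    · subst ha
      rw [isSucc_oadd_zero, decide_eq_false_iff_not] at h
      rw [fundSeq_oadd_zero]
      have hpos : (terms (fundSeq (oadd e 1 0) x)).card ≥ 1 := by
        cases hs : isSucc e
        · rw [fundSeq_opow_limit h hs]
          simp
        · rw [fundSeq_opow_succ hs]
          simpa using hx
      have := c.pos
      simp
      omega
    · rw [isSucc_oadd ha] at h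
      rw [fundSeq_oadd ha, terms_oadd, terms_oadd, Multiset.card_add, Multiset.card_add]
      exact Nat.add_le_add_left (card_terms_le_fundSeq hx h) _

/-! ### The Cichoń hierarchy -/

@[simp] theorem cichon_zero (h : ℕ → ℕ) (x : ℕ) : cichon h 0 x = 0 := by
  rw [cichon, dif_pos rfl]

theorem cichon_succ (h : ℕ → ℕ) {a : ONote} (ha : isSucc a = true) (x : ℕ) :
    cichon h a x = 1 + cichon h (fundSeq a x) (h x) := by
  rw [cichon, dif_neg (ne_zero_of_isSucc ha), if_pos ha]

theorem cichon_limit (h : ℕ → ℕ) {a : ONote} (ha : isSucc a = false) (x : ℕ) :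
    cichon h a x = cichon h (fundSeq a x) x := by
  by_cases h0 : a = 0
  · simp [h0]
  · rw [cichon, dif_neg h0, if_neg (by simp [ha])]

theorem cichon_predAt (h : ℕ → ℕ) {x : ℕ} (hx : 1 ≤ x) {a : ONote} (ha : a ≠ 0) :
    cichon h a x = 1 + cichon h (predAt x a) (h x) := by
  have := fundSeq_lt a x ha
  cases hs : isSucc a
  · rw [cichon_limit h hs, predAt_limit hs, cichon_predAt h hx (fundSeq_ne_zero ha hs hx)]
  · rw [cichon_succ h hs, predAt_succ hs]
termination_by a

theorem cichon_mono_aux {h : ℕ → ℕ} (hm : Monotone h) (hx : ∀ x, x ≤ h x) (a : ONote) :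
    (∀ x y, x ≤ y → cichon h a x ≤ cichon h a y) ∧
      ∀ x b, Descends x a b → cichon h b x ≤ cichon h a x := by
  by_cases h0 : a = 0
  · subst h0
    refine ⟨fun x y _ => by simp, fun x b hb => ?_⟩
    have : b = 0 := by
      induction hb with
      | refl => rfl
      | tail _ hbc ih => rw [hbc, ih, fundSeq_zero]
    rw [this]
  · have hlt := fun x => fundSeq_lt a x h0
    have hdesc : ∀ x b, Descends x a b → cichon h b x ≤ cichon h a x := by
      intro x b hb
      have := hlt x
      have ih := cichon_mono_aux hm hx (fundSeq a x)
      rcases hb.eq_or_step with rfl | hb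
      · rfl
      · refine (ih.2 x b hb).trans ?_
        cases hs : isSucc a
        · rw [cichon_limit h hs]
        · rw [cichon_succ h hs]
          exact (ih.1 x _ (hx x)).trans (Nat.le_add_left _ _)
    refine ⟨fun x y hxy => ?_, hdesc⟩
    have := hlt y
    have ih := cichon_mono_aux hm hx (fundSeq a y)
    cases hs : isSucc a
    · rcases hxy.eq_or_lt with rfl | hlt
      · rfl
      · have := hlt
        have := fundSeq_lt a x h0
        rw [cichon_limit h hs, cichon_limit h hs]
        exact ((cichon_mono_aux hm hx (fundSeq a x)).1 x y hxy).trans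
          (ih.2 y _ (Descends.fundSeq_of_le hxy (by omega) hs))
    · rw [cichon_succ h hs, cichon_succ h hs, fundSeq_congr_of_isSucc hs x y]
      exact Nat.add_le_add_left (ih.1 _ _ (hm hxy)) _
termination_by a

theorem cichon_mono {h : ℕ → ℕ} (hm : Monotone h) (hx : ∀ x, x ≤ h x) (a : ONote) :
    Monotone (cichon h a) := fun x y => (cichon_mono_aux hm hx a).1 x y

theorem Descends.cichon_le {h : ℕ → ℕ} (hm : Monotone h) (hx : ∀ x, x ≤ h x) {a b : ONote} {x : ℕ}
    (hab : Descends x a b) : cichon h b x ≤ cichon h a x := (cichon_mono_aux hm hx a).2 x b hab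

theorem card_terms_le_cichon {h : ℕ → ℕ} (hx : ∀ x, x ≤ h x) {x : ℕ} (h1 : 1 ≤ x) (a : ONote) :
    (terms a).card ≤ cichon h a x := by
  by_cases h0 : a = 0
  · simp [h0]
  · have := fundSeq_lt a x h0
    cases hs : isSucc a
    · rw [cichon_limit h hs]
      exact (card_terms_le_fundSeq h1 hs).trans (card_terms_le_cichon hx h1 _)
    · rw [cichon_succ h hs, card_terms_of_isSucc x hs, Nat.add_comm]
      exact Nat.add_le_add_left (card_terms_le_cichon hx (h1.trans (hx x)) _) _
termination_by a

/-- The elements of `δₙ(α)` lie on the descent path of index `y` from `P_x(α)`: when the last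
summand of `α` is replaced this is because `Dₙ` has coefficients below `x`, and when an earlier
summand is replaced, the remaining tail of `α` is more than enough. -/
theorem descends_predAt_of_mem_derivList {ℓ n k y : ℕ} (hℓ : 1 ≤ ℓ) (hnk : 1 ≤ n * k)
    (hy : ℓ + ℓ * n * k < y) : ∀ {α : ONote}, NF α → α < towerNote (k + 1) → IsLean ℓ α →
    ∀ u ∈ derivList n α, Descends y (predAt (ℓ + ℓ * n * k) α) u
  | zero, _, _, _, _, hu => by simp [derivList] at hu
  | oadd e c a, hα, hk, hl, u, hu => by
    have hx : 1 ≤ ℓ + ℓ * n * k := by omega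
    have he := hα.fst
    have hlean := IsLean.derivList hα hk hl hu
    have hspec := derivList_spec n hα u hu
    by_cases ha : a = 0
    · subst ha
      have hk' : e < towerNote k := lt_towerNote_of_mem_terms hα hk (head_mem_terms e c 0)
      have hD := IsLean.expDeriv n he hk' hl.1
      have hDb := expDeriv_below n he
      have hu' : u = consTerm e (c - 1) (expDeriv n e) := by
        rw [derivList] at hu
        rw [show derivList n (0 : ONote) = [] from rfl, List.map_nil, List.mem_singleton] at hu
        rw [hu]
        apply terms_inj (natSum_nf (consTerm_nf he _) hDb.nf)
          (consTerm_below' he (Order.lt_succ _) hDb).nf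
        simp
      have hlt : ℓ * n * k < ℓ + ℓ * n * k := by omega
      rw [predAt_oadd_zero hx, hu']
      apply Descends.consTerm
      have h1 : NF (oadd e 1 0) := NF.oadd_zero _ _
      apply Descends.of_isLean (by omega) (predAt_nf _ h1) hDb.nf _ hD
      refine le_predAt_of_isLean hlt h1 hDb.nf ?_ hD
      exact hDb.repr_lt.trans_le (omega0_le_oadd _ _ _)
    · rw [predAt_oadd hx ha]
      rw [derivList, List.mem_cons, List.mem_map] at hu
      rcases hu with hu | ⟨v, hv, rfl⟩
      · have hlt : u < oadd e c 0 := by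
          rw [hu]
          exact natSum_consTerm_lt he (natSum_below hα.snd' (expDeriv_below n he))
        refine ((Descends.zero y (predAt (ℓ + ℓ * n * k) a)).oadd e c).trans ?_
        exact Descends.of_isLean hy (NF.oadd_zero _ _) hspec.1 hlt.le hlean
      · have hv' := derivList_spec n hα.snd v hv
        have hvb : NFBelow v (repr e) :=
          NF.below_of_lt' (lt_trans (lt_def.1 hv'.2) hα.snd'.repr_lt) hv'.1
        rw [show natSum (oadd e c 0) v = insertTerm e c v from rfl, insertTerm_of_below he hvb]
        apply Descends.oadd
        refine descends_predAt_of_mem_derivList hℓ hnk hy hα.snd ?_ hl.2.2 v hv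
        rw [lt_towerNote_succ hα] at hk
        rw [lt_towerNote_succ hα.snd]
        exact hk.snd.mono hk.lt.le

end ONote

/-! ### The recursion for the length bound -/

namespace NONote

open ONote

theorem maxLen_le {g : ℕ → ℕ} {α : NONote} {n B : ℕ}
    (h : ∀ β ∈ deriv n α, 1 + maxLen g β (g n) ≤ B) : maxLen g α n ≤ B := by
  have aux : ∀ l : List ℕ, (∀ x ∈ l, x ≤ B) → l.foldr max 0 ≤ B := by
    intro l hl
    induction l with
    | nil => exact Nat.zero_le _
    | cons x l ih =>
      exact max_le (hl x (by simp)) (ih fun y hy => hl y (by simp [hy]))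
  rw [maxLen]
  apply aux
  intro x hx
  obtain ⟨β, -, rfl⟩ := List.mem_map.1 hx
  exact h β.1 β.2

theorem succ_maxLen_le {g : ℕ → ℕ} {α β : NONote} {n : ℕ} (h : β ∈ deriv n α) :
    1 + maxLen g β (g n) ≤ maxLen g α n := by
  have aux : ∀ l : List ℕ, ∀ x ∈ l, x ≤ l.foldr max 0 := by
    intro l x hx
    induction l with
    | nil => simp at hx
    | cons y l ih =>
      rcases List.mem_cons.1 hx with rfl | hx
      · exact le_max_left _ _
      · exact (ih hx).trans (le_max_right _ _)
  conv_rhs => rw [maxLen]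
  exact aux _ _ (List.mem_map.2 ⟨⟨β, h⟩, List.mem_attach _ _, rfl⟩)

/-- If all derivatives that occur vanish, every step removes a summand. -/
theorem maxLen_le_card_terms {g : ℕ → ℕ} (g0 : g 0 = 0) {k : ℕ} (α : NONote) :
    ∀ {n : ℕ}, n * k = 0 → α < tower (k + 1) → maxLen g α n ≤ (terms α.1).card := by
  intro n hnk hα
  apply maxLen_le
  intro β hβ
  have hlt := lt_of_mem_deriv hβ
  obtain ⟨e, he, hβe⟩ := (mem_derivList n α.2).1 (mem_deriv.1 hβ)
  have hD : expDeriv n e = 0 := by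
    rcases Nat.mul_eq_zero.1 hnk with rfl | rfl
    · exact expDeriv_zero_left (α.2.mem_terms he)
    · rw [lt_towerNote_zero.1 (lt_towerNote_of_mem_terms α.2 hα he)]
      rfl
  have hgn : g n * k = 0 := by
    rcases Nat.mul_eq_zero.1 hnk with rfl | rfl
    · rw [g0, Nat.zero_mul]
    · rfl
  have ih := maxLen_le_card_terms g0 β hgn (hlt.trans hα)
  have hcard : (terms α.1).card = (terms β.1).card + 1 := by
    rw [hβe, hD, terms_natSum, terms_zero, add_zero, terms_eraseTerm,
      Multiset.card_erase_add_one he]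
  omega
termination_by α

/-- With `x = ℓ + ℓ * n * k`, the elements of `δₙ(α)` are `x`-lean, and by superadditivity the
argument that belongs to them at `g n` is at most `h x = x * g x`. -/
theorem maxLen_le_cichon {g : ℕ → ℕ} (hg : StrictMono g) (hsup : ∀ x y, g x + g y ≤ g (x + y))
    {k : ℕ} (α : NONote) : ∀ {ℓ n : ℕ}, α < tower (k + 1) → IsLean ℓ α.1 →
      maxLen g α n ≤ cichon (fun x => x * g x) α.1 (ℓ + ℓ * n * k) := by
  intro ℓ n hα hl
  have hgx : ∀ x, x ≤ g x := fun _ => hg.le_apply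
  have hm : Monotone fun x => x * g x := fun x y hxy => Nat.mul_le_mul hxy (hg.monotone hxy)
  have hx : ∀ x, x ≤ x * g x := fun x => by
    rcases Nat.eq_zero_or_pos x with rfl | h
    · simp
    · exact Nat.le_mul_of_pos_right _ (h.trans_le (hgx x))
  by_cases h0 : α.1 = 0
  · apply maxLen_le
    intro β hβ
    rw [mem_deriv, h0] at hβ
    exact absurd hβ (by simp [show derivList n (0 : ONote) = [] from rfl])
  have hℓ : 1 ≤ ℓ := by
    obtain ⟨a, ha⟩ := α
    obtain _ | ⟨e, c, a⟩ := a
    · exact absurd rfl h0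
    · exact c.pos.trans_le hl.2.1
  have hpos : 1 ≤ ℓ + ℓ * n * k := by omega
  -- if `n * k = 0`, then possibly `h x = x` for `x = ℓ + ℓ * n * k`, and the descent from `P_x(α)`
  -- with index `h x` need not reach `δₙ(α)`
  by_cases hnk : n * k = 0
  · have g0 : g 0 = 0 := by
      have := hsup 0 0
      simpa using this
    exact (maxLen_le_card_terms g0 α hnk hα).trans (card_terms_le_cichon hx hpos _)
  apply maxLen_le
  intro β hβ
  have hlt := lt_of_mem_deriv hβ
  have hβ' := mem_deriv.1 hβ
  have hβl := IsLean.derivList α.2 hα hl hβ'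
  have ih := maxLen_le_cichon hg hsup β (n := g n) (hlt.trans hα) hβl
  rw [cichon_predAt _ hpos h0]
  apply Nat.add_le_add_left
  have hnk' : 1 ≤ n * k := Nat.pos_of_ne_zero hnk
  -- superadditivity gives `1 + k * g n ≤ g (1 + k * n)`
  have hgk : 1 + g n * k ≤ g (ℓ + ℓ * n * k) := by
    have h1 : ∀ j, g n * j ≤ g (n * j) := by
      intro j
      induction j with
      | zero => simp
      | succ j ih =>
        rw [Nat.mul_succ, Nat.mul_succ]
        exact (Nat.add_le_add_right ih _).trans (hsup _ _)
    calc 1 + g n * k ≤ g 1 + g (n * k) := add_le_add (hgx 1) (h1 k)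
      _ ≤ g (1 + n * k) := hsup _ _
      _ ≤ g (ℓ + ℓ * n * k) := by
        apply hg.monotone
        rw [Nat.mul_assoc]
        exact add_le_add hℓ (Nat.le_mul_of_pos_left _ hℓ)
  have hle : ℓ + ℓ * n * k + (ℓ + ℓ * n * k) * g n * k ≤
      (ℓ + ℓ * n * k) * g (ℓ + ℓ * n * k) := by
    calc _ = (ℓ + ℓ * n * k) * (1 + g n * k) := by ring
      _ ≤ _ := Nat.mul_le_mul_left _ hgk
  refine ih.trans ((cichon_mono hm hx _ hle).trans ?_)
  refine Descends.cichon_le hm hx (descends_predAt_of_mem_derivList hℓ hnk' ?_ α.2 hα hl _ hβ')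
  have hx2 : 2 ≤ ℓ + ℓ * n * k := by
    rw [Nat.mul_assoc]
    exact Nat.add_le_add hℓ (Nat.mul_pos hℓ hnk')
  have := hgx (ℓ + ℓ * n * k)
  nlinarith
termination_by α

end NONote

/-! ### Embeddings of multisets -/

namespace Multiset

variable {α β : Type*}

/-- The multiset extension of a relation: an injection of `m` into `m'` along `r`. -/
def Embeds (r : α → α → Prop) (m m' : Multiset α) : Prop := ∃ m₀ ≤ m', Rel r m m₀

/-- The multiset extension `∑_{a ∈ m} (1 + ν a)` of a norm. -/
def normSum (ν : α → ℕ) (m : Multiset α) : ℕ := (m.map fun a => 1 + ν a).sum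

/-- The elements of the left summand. -/
def lefts (m : Multiset (α ⊕ β)) : Multiset α := m.filterMap Sum.getLeft?

/-- The elements of the right summand. -/
def rights (m : Multiset (α ⊕ β)) : Multiset β := m.filterMap Sum.getRight?

theorem Embeds.zero (r : α → α → Prop) (m : Multiset α) : Embeds r 0 m :=
  ⟨0, zero_le _, Rel.zero⟩

theorem embeds_zero_right {r : α → α → Prop} {m : Multiset α} (h : Embeds r m 0) : m = 0 := by
  obtain ⟨m₀, h0, hr⟩ := h
  rw [Multiset.le_zero] at h0
  subst h0
  exact rel_zero_right.1 hr

theorem Embeds.add {r : α → α → Prop} {a b c d : Multiset α} (h : Embeds r a b)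
    (h' : Embeds r c d) : Embeds r (a + c) (b + d) := by
  obtain ⟨m, hm, hr⟩ := h
  obtain ⟨m', hm', hr'⟩ := h'
  exact ⟨m + m', add_le_add hm hm', hr.add hr'⟩

theorem Embeds.cons {r : α → α → Prop} {a b : α} {m m' : Multiset α} (hab : r a b)
    (h : Embeds r m m') : Embeds r (a ::ₘ m) (b ::ₘ m') := by
  obtain ⟨m₀, h0, hr⟩ := h
  exact ⟨b ::ₘ m₀, cons_le_cons b h0, hr.cons hab⟩

theorem Embeds.of_map {r : α → α → Prop} {s : β → β → Prop} {f : α → β}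
    (hf : ∀ x y, s (f x) (f y) → r x y) {m m' : Multiset α} (h : Embeds s (m.map f) (m'.map f)) :
    Embeds r m m' := by
  obtain ⟨m₀, h0, hr⟩ := h
  obtain ⟨m₁, h1, rfl⟩ : ∃ m₁ ≤ m', m₁.map f = m₀ := by
    induction m' using Quotient.inductionOn with | _ l' =>
    induction m₀ using Quotient.inductionOn with | _ l₀ =>
    obtain ⟨l₁, hl₁, hs⟩ := Multiset.coe_le.1 h0
    obtain ⟨l₂, hl₂, rfl⟩ := List.sublist_map_iff.1 hs
    exact ⟨l₂, Multiset.coe_le.2 hl₂.subperm, Quot.sound hl₁⟩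
  rw [rel_map] at hr
  exact ⟨m₁, h1, hr.mono fun a _ b _ => hf a b⟩

theorem Embeds.map {r : α → α → Prop} {s : β → β → Prop} {f : α → β}
    (hf : ∀ x y, r x y → s (f x) (f y)) {m m' : Multiset α} (h : Embeds r m m') :
    Embeds s (m.map f) (m'.map f) := by
  obtain ⟨m₀, h0, hr⟩ := h
  exact ⟨m₀.map f, map_le_map h0, rel_map.2 (hr.mono fun a _ b _ => hf a b)⟩

theorem Embeds.of_card_le {r : α → α → Prop} {m m' : Multiset α} (hm : ∀ a ∈ m, ∀ b, r a b)
    (h : card m ≤ card m') : Embeds r m m' := by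
  obtain ⟨m₀, h0, hc⟩ : ∃ m₀ ≤ m', card m₀ = card m := by
    induction m' using Quotient.inductionOn with | _ l =>
    exact ⟨_, Multiset.coe_le.2 (l.take_sublist (card m)).subperm, by simpa using h⟩
  exact ⟨m₀, h0, rel_of_forall (fun a b ha _ => hm a ha b) hc.symm⟩

@[simp] theorem lefts_add (m m' : Multiset (α ⊕ β)) : lefts (m + m') = lefts m + lefts m' :=
  filterMap_add _ _ _

@[simp] theorem rights_add (m m' : Multiset (α ⊕ β)) : rights (m + m') = rights m + rights m' :=
  filterMap_add _ _ _

@[simp] theorem lefts_cons_inl (a : α) (m : Multiset (α ⊕ β)) :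
    lefts (Sum.inl a ::ₘ m) = a ::ₘ lefts m := filterMap_cons_some _ _ _ rfl

@[simp] theorem lefts_cons_inr (b : β) (m : Multiset (α ⊕ β)) :
    lefts (Sum.inr b ::ₘ m) = lefts m := filterMap_cons_none _ _ rfl

@[simp] theorem rights_cons_inl (a : α) (m : Multiset (α ⊕ β)) :
    rights (Sum.inl a ::ₘ m) = rights m := filterMap_cons_none _ _ rfl

@[simp] theorem rights_cons_inr (b : β) (m : Multiset (α ⊕ β)) :
    rights (Sum.inr b ::ₘ m) = b ::ₘ rights m := filterMap_cons_some _ _ _ rfl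

@[simp] theorem lefts_map_inl (m : Multiset α) : lefts (m.map (Sum.inl : α → α ⊕ β)) = m := by
  induction m using Multiset.induction with
  | empty => rfl
  | cons a m ih => simpa using ih

@[simp] theorem lefts_map_inr (m : Multiset β) : lefts (m.map (Sum.inr : β → α ⊕ β)) = 0 := by
  induction m using Multiset.induction with
  | empty => rfl
  | cons a m ih => simpa using ih

@[simp] theorem rights_map_inl (m : Multiset α) : rights (m.map (Sum.inl : α → α ⊕ β)) = 0 := by
  induction m using Multiset.induction with
  | empty => rfl
  | cons a m ih => simpa using ih

@[simp] theorem rights_map_inr (m : Multiset β) : rights (m.map (Sum.inr : β → α ⊕ β)) = m := by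
  induction m using Multiset.induction with
  | empty => rfl
  | cons a m ih => simpa using ih

theorem lefts_add_rights (m : Multiset (α ⊕ β)) :
    (lefts m).map Sum.inl + (rights m).map Sum.inr = m := by
  induction m using Multiset.induction with
  | empty => rfl
  | cons a m ih =>
    conv_rhs => rw [← ih]
    cases a <;> simp

theorem embeds_sum {r : α → α → Prop} {s : β → β → Prop} {m m' : Multiset (α ⊕ β)} :
    Embeds (Sum.LiftRel r s) m m' ↔
      Embeds r (lefts m) (lefts m') ∧ Embeds s (rights m) (rights m') := by
  constructor
  · rintro ⟨m₀, h0, hr⟩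
    suffices h : Rel r (lefts m) (lefts m₀) ∧ Rel s (rights m) (rights m₀) from
      ⟨⟨_, filterMap_le_filterMap _ h0, h.1⟩, ⟨_, filterMap_le_filterMap _ h0, h.2⟩⟩
    clear h0
    induction hr with
    | zero => exact ⟨Rel.zero, Rel.zero⟩
    | cons hab _ ih =>
      cases hab with
      | inl h => exact ⟨by simpa using ih.1.cons h, by simpa using ih.2⟩
      | inr h => exact ⟨by simpa using ih.1, by simpa using ih.2.cons h⟩
  · rintro ⟨h1, h2⟩
    rw [← lefts_add_rights m, ← lefts_add_rights m']
    exact (h1.map fun _ _ => Sum.LiftRel.inl).add (h2.map fun _ _ => Sum.LiftRel.inr)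

@[simp] theorem normSum_add (ν : α → ℕ) (m m' : Multiset α) :
    normSum ν (m + m') = normSum ν m + normSum ν m' := by
  simp [normSum]

@[simp] theorem normSum_cons (ν : α → ℕ) (a : α) (m : Multiset α) :
    normSum ν (a ::ₘ m) = 1 + ν a + normSum ν m := by
  simp [normSum]

@[simp] theorem normSum_map (ν : β → ℕ) (f : α → β) (m : Multiset α) :
    normSum ν (m.map f) = normSum (fun a => ν (f a)) m := by
  simp [normSum]

theorem normSum_mono {ν μ : α → ℕ} (h : ∀ a, ν a ≤ μ a) (m : Multiset α) :
    normSum ν m ≤ normSum μ m :=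
  sum_map_le_sum_map _ _ fun a _ => Nat.add_le_add_left (h a) 1

theorem normSum_sum (ν : α → ℕ) (μ : β → ℕ) (m : Multiset (α ⊕ β)) :
    normSum (Sum.elim ν μ) m = normSum ν (lefts m) + normSum μ (rights m) := by
  conv_lhs => rw [← lefts_add_rights m]
  simp

theorem card_le_normSum (ν : α → ℕ) (m : Multiset α) : card m ≤ normSum ν m := by
  induction m using Multiset.induction with
  | empty => simp
  | cons a m ih =>
    rw [card_cons, normSum_cons]
    omega

theorem le_normSum_of_mem (ν : α → ℕ) {m : Multiset α} {a : α} (h : a ∈ m) :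
    ν a ≤ normSum ν m := by
  obtain ⟨m, rfl⟩ := exists_cons_of_mem h
  rw [normSum_cons]
  omega

open Classical in
/-- Hall's theorem for multiset embeddings: if `a` does not embed into `x`, then for some `b ∈ a`
all but fewer than `card a` elements of `x` are outside the upward closure of `b`, and the exceptions
are in the upward closure of `a`. -/
theorem exists_decomposition_of_not_embeds {r : α → α → Prop} {a x : Multiset α}
    (h : ¬ Embeds r a x) :
    ∃ b ∈ a, ∃ u w, x = u + w ∧ card u < card a ∧ (∀ z ∈ u, ∃ b' ∈ a, r b' z) ∧
      ∀ z ∈ w, ¬ r b z := by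
  induction a using Quotient.inductionOn with | _ la =>
  induction x using Quotient.inductionOn with | _ lx =>
  change ¬ Embeds r (la : Multiset α) (lx : Multiset α) at h
  have huniv : ∀ l : List α,
      (l : Multiset α) = (Finset.univ (α := Fin l.length)).val.map l.get := by
    intro l
    rw [Fin.univ_val_map, List.ofFn_get]
  let N : Fin la.length → Finset (Fin lx.length) := fun i =>
    Finset.univ.filter fun j => r (la.get i) (lx.get j)
  by_cases hall : ∀ s : Finset (Fin la.length), s.card ≤ (s.biUnion N).card
  · obtain ⟨f, hf, hr⟩ := (Finset.all_card_le_biUnion_card_iff_exists_injective N).1 hall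
    refine absurd ⟨(Finset.univ (α := Fin la.length)).val.map fun i => lx.get (f i), ?_, ?_⟩ h
    · rw [huniv lx, show (fun i => lx.get (f i)) = lx.get ∘ f from rfl, ← map_map]
      apply map_le_map
      have hnd : (Finset.univ.val.map f).Nodup := Finset.univ.nodup.map hf
      exact (le_iff_subset hnd).2 fun y _ => Finset.mem_univ y
    · rw [huniv la, rel_map]
      refine rel_refl_of_refl_on fun i _ => ?_
      have := hr i
      simpa [N] using this
  · push Not at hall
    obtain ⟨s, hs⟩ := hall
    obtain ⟨i, hi⟩ : s.Nonempty := by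
      rw [Finset.nonempty_iff_ne_empty]
      rintro rfl
      simp at hs
    refine ⟨la.get i, List.get_mem la i, (s.biUnion N).val.map lx.get,
      (s.biUnion N)ᶜ.val.map lx.get, ?_, ?_, ?_, ?_⟩
    · rw [← Multiset.map_add]
      change (lx : Multiset α) = _
      rw [huniv lx]
      congr 1
      rw [← Finset.union_compl (s.biUnion N), ← Finset.disjUnion_eq_union _ _ disjoint_compl_right,
        Finset.disjUnion_val]
    · rw [card_map]
      refine hs.trans_le (s.card_le_univ.trans ?_)
      rw [Fintype.card_fin]
      exact le_rfl
    · intro z hz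
      obtain ⟨j, hj, rfl⟩ := mem_map.1 hz
      obtain ⟨i', -, hi'⟩ := Finset.mem_biUnion.1 hj
      exact ⟨la.get i', List.get_mem la i', by simpa [N] using hi'⟩
    · intro z hz
      obtain ⟨j, hj, rfl⟩ := mem_map.1 hz
      intro hr
      exact Finset.mem_compl.1 hj (Finset.mem_biUnion.2 ⟨i, hi, by simpa [N] using hr⟩)

end Multiset

/-! ### Reflections -/

namespace NestedMultiset

open Multiset (Embeds normSum lefts rights)

/-- A reflection of the whole of `A` into `B`. -/
def Reflects (A B : NestedMultiset) : Prop :=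
  ∃ r : A.Carrier → B.Carrier,
    (∀ x y, B.le (r x) (r y) → A.le x y) ∧ ∀ x, B.norm (r x) ≤ A.norm x

theorem Reflects.refl (A : NestedMultiset) : Reflects A A := ⟨id, fun _ _ h => h, fun _ => le_rfl⟩

theorem Reflects.trans {A B C : NestedMultiset} : Reflects A B → Reflects B C → Reflects A C :=
  fun ⟨r, h1, h2⟩ ⟨s, h3, h4⟩ =>
    ⟨s ∘ r, fun _ _ h => h1 _ _ (h3 _ _ h), fun x => (h4 _).trans (h2 x)⟩

theorem Reflects.reflectsInto_univ {A B : NestedMultiset} : Reflects A B →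
    ReflectsInto (Set.univ : Set A.Carrier) B :=
  fun ⟨r, h1, h2⟩ => ⟨fun x => r x.1, fun _ _ h => h1 _ _ h, fun x => h2 x.1⟩

theorem ReflectsInto.trans {A B C : NestedMultiset} {S : Set A.Carrier} :
    ReflectsInto S B → Reflects B C → ReflectsInto S C :=
  fun ⟨r, h1, h2⟩ ⟨s, h3, h4⟩ =>
    ⟨fun x => s (r x), fun _ _ h => h1 _ _ (h3 _ _ h), fun x => (h4 _).trans (h2 x)⟩

theorem ReflectsInto.mono {A B : NestedMultiset} {S T : Set A.Carrier} (hST : S ⊆ T) :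
    ReflectsInto T B → ReflectsInto S B :=
  fun ⟨r, h1, h2⟩ =>
    ⟨fun x => r ⟨x.1, hST x.2⟩, fun _ _ h => h1 _ _ h, fun x => h2 ⟨x.1, hST x.2⟩⟩

theorem reflectsInto_of_isEmpty {A : NestedMultiset} {S : Set A.Carrier} (h : ∀ x, x ∉ S)
    (B : NestedMultiset) : ReflectsInto S B :=
  ⟨fun x => absurd x.2 (h _), fun x => absurd x.2 (h _), fun x => absurd x.2 (h _)⟩

theorem Reflects.sum {A B C D : NestedMultiset} : Reflects A B → Reflects C D →
    Reflects (sum A C) (sum B D) := by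
  rintro ⟨r, h1, h2⟩ ⟨s, h3, h4⟩
  refine ⟨Sum.map r s, ?_, ?_⟩
  · rintro (x | x) (y | y) (h | h)
    · exact Sum.LiftRel.inl (h1 _ _ h)
    · exact Sum.LiftRel.inr (h3 _ _ h)
  · rintro (x | x)
    · exact h2 x
    · exact h4 x

theorem reflects_sum_right (A B : NestedMultiset) : Reflects B (sum A B) :=
  ⟨Sum.inr, fun _ _ h => by cases h; assumption, fun _ => le_rfl⟩

theorem reflects_empty_sum (A : NestedMultiset) : Reflects (sum empty A) A := by
  refine ⟨Sum.elim Empty.elim id, ?_, ?_⟩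
  · rintro (x | x) (y | y) h
    · exact x.elim
    · exact x.elim
    · exact y.elim
    · exact Sum.LiftRel.inr h
  · rintro (x | x)
    · exact x.elim
    · exact le_rfl

theorem reflects_sum_assoc (A B C : NestedMultiset) :
    Reflects (sum (sum A B) C) (sum A (sum B C)) := by
  refine ⟨Equiv.sumAssoc _ _ _, ?_, ?_⟩
  · rintro ((x | x) | x) ((y | y) | y) (h | h)
    · exact Sum.LiftRel.inl (Sum.LiftRel.inl h)
    · cases h
      exact Sum.LiftRel.inl (Sum.LiftRel.inr (by assumption))
    · cases h
    · cases h
    · cases h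
      exact Sum.LiftRel.inr (by assumption)
  · rintro ((x | x) | x) <;> exact le_rfl

theorem reflects_sum_left_comm (A B C : NestedMultiset) :
    Reflects (sum A (sum B C)) (sum B (sum A C)) := by
  refine ⟨Sum.elim (fun a => Sum.inr (Sum.inl a))
    (Sum.elim (fun b => Sum.inl b) (fun c => Sum.inr (Sum.inr c))), ?_, ?_⟩
  · rintro (x | x | x) (y | y | y) (h | h)
    · cases h
      exact Sum.LiftRel.inl (by assumption)
    · cases h
    · exact Sum.LiftRel.inr (Sum.LiftRel.inl h)
    · cases h
    · cases h
      exact Sum.LiftRel.inr (Sum.LiftRel.inr (by assumption))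
  · rintro (x | x | x) <;> exact le_rfl

theorem Reflects.mset {A B : NestedMultiset} : Reflects A B → Reflects (mset A) (mset B) := by
  rintro ⟨r, h1, h2⟩
  refine ⟨fun m : Multiset A.Carrier => m.map r, fun _ _ h => Multiset.Embeds.of_map h1 h,
    fun m => ?_⟩
  exact (Multiset.normSum_map B.norm r m).trans_le (Multiset.normSum_mono h2 m)

theorem copies_eq_sumList (A : NestedMultiset) : ∀ m, copies A m = sumList (List.replicate m A)
  | 0 => rfl
  | m + 1 => by rw [copies, copies_eq_sumList A m]; rfl

theorem reflects_sumList_append : ∀ l l' : List NestedMultiset,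
    Reflects (sum (sumList l) (sumList l')) (sumList (l ++ l'))
  | [], _ => reflects_empty_sum _
  | _ :: l, l' => (reflects_sum_assoc _ _ _).trans
      ((Reflects.refl _).sum (reflects_sumList_append l l'))

theorem sumList_append_reflects : ∀ l l' : List NestedMultiset,
    Reflects (sumList (l ++ l')) (sum (sumList l) (sumList l'))
  | [], _ => reflects_sum_right _ _
  | A :: l, l' => by
    refine ((Reflects.refl A).sum (sumList_append_reflects l l')).trans ?_
    refine ⟨(Equiv.sumAssoc _ _ _).symm, ?_, ?_⟩
    · rintro (x | x | x) (y | y | y) (h | h)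
      · cases h
        exact Sum.LiftRel.inl (by assumption)
      · cases h
      · cases h
      · cases h
        exact Sum.LiftRel.inr (Sum.LiftRel.inl (by assumption))
      · exact Sum.LiftRel.inr (Sum.LiftRel.inr h)
    · rintro (x | x | x) <;> exact le_rfl

theorem reflects_sumList_of_perm {l l' : List NestedMultiset} (h : l.Perm l') :
    Reflects (sumList l) (sumList l') := by
  induction h with
  | nil => exact Reflects.refl _
  | cons _ _ ih => exact (Reflects.refl _).sum ih
  | swap _ _ _ => exact reflects_sum_left_comm _ _ _
  | trans _ _ ih ih' => exact ih.trans ih'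

theorem reflects_sumList_of_sublist {l l' : List NestedMultiset} (h : l.Sublist l') :
    Reflects (sumList l) (sumList l') := by
  induction h with
  | slnil => exact Reflects.refl _
  | cons _ _ ih => exact ih.trans (reflects_sum_right _ _)
  | cons_cons _ _ ih => exact (Reflects.refl _).sum ih

theorem reflects_sumList_of_forall₂ {l l' : List NestedMultiset} (h : List.Forall₂ Reflects l l') :
    Reflects (sumList l) (sumList l') := by
  induction h with
  | nil => exact Reflects.refl _
  | cons hab _ ih => exact hab.sum ih

/-! ### Canonical nwqos -/

/-- `∑_{e ∈ l} mset (C(e))`. -/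
def canonList (l : List ONote) : NestedMultiset := sumList (l.map fun e => mset (canon e))

theorem reflects_canonList_of_subperm {l l' : List ONote} (h : l.Subperm l') :
    Reflects (canonList l) (canonList l') := by
  obtain ⟨l₀, hp, hs⟩ := h
  exact (reflects_sumList_of_perm (hp.symm.map _)).trans (reflects_sumList_of_sublist (hs.map _))

theorem canonList_replicate (e : ONote) (c : ℕ) :
    canonList (List.replicate c e) = copies (mset (canon e)) c := by
  rw [canonList, List.map_replicate, copies_eq_sumList]

theorem canon_reflects_canonList : ∀ a : ONote, Reflects (canon a) (canonList (ONote.termList a))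
  | ONote.zero => Reflects.refl _
  | ONote.oadd e c a => by
    refine ((Reflects.refl _).sum (canon_reflects_canonList a)).trans ?_
    rw [← canonList_replicate, ONote.termList, canonList, canonList, canonList, List.map_append]
    exact reflects_sumList_append _ _

theorem canonList_reflects_canon : ∀ a : ONote, Reflects (canonList (ONote.termList a)) (canon a)
  | ONote.zero => Reflects.refl _
  | ONote.oadd e c a => by
    refine Reflects.trans ?_ ((Reflects.refl _).sum (canonList_reflects_canon a))
    rw [← canonList_replicate, ONote.termList, canonList, canonList, canonList, List.map_append]
    exact sumList_append_reflects _ _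

theorem canonList_reflects_canon_of_le {l : List ONote} {a : ONote}
    (h : (l : Multiset ONote) ≤ ONote.terms a) : Reflects (canonList l) (canon a) :=
  (reflects_canonList_of_subperm (Multiset.coe_le.1 h)).trans (canonList_reflects_canon a)

theorem reflects_canon_natSum {A B : NestedMultiset} {a b : ONote} (hA : Reflects A (canon a))
    (hB : Reflects B (canon b)) : Reflects (sum A B) (canon (ONote.natSum a b)) := by
  refine ((hA.trans (canon_reflects_canonList a)).sum
    (hB.trans (canon_reflects_canonList b))).trans ?_
  refine (reflects_sumList_append _ _).trans ?_
  rw [← List.map_append]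
  refine canonList_reflects_canon_of_le (le_of_eq ?_)
  rw [ONote.terms_natSum, ONote.terms, ONote.terms, Multiset.coe_add]

theorem reflects_canon_natMul {A : NestedMultiset} {a : ONote} (hA : Reflects A (canon a)) :
    ∀ m, Reflects (copies A m) (canon (ONote.natMul a m))
  | 0 => Reflects.refl _
  | m + 1 => reflects_canon_natSum hA (reflects_canon_natMul hA m)

theorem reflects_canon_opow {A : NestedMultiset} {a : ONote} (hA : Reflects A (canon a)) :
    Reflects (mset A) (canon (ONote.oadd a 1 0)) := by
  refine hA.mset.trans (Reflects.trans (B := canonList [a]) ?_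
    (canonList_reflects_canon_of_le (by simp)))
  exact ⟨Sum.inl, fun _ _ h => by cases h; assumption, fun _ => le_rfl⟩

theorem reflects_canon_orderType : ∀ A : NestedMultiset, Reflects A (canon A.orderType.1)
  | empty => Reflects.refl _
  | sum A B => reflects_canon_natSum (reflects_canon_orderType A) (reflects_canon_orderType B)
  | mset A => reflects_canon_opow (reflects_canon_orderType A)

/-! ### The order type of `Rₙ(A, a)` -/

/-- The list `L` of nwqos is dominated by part of the multiset `E` of ordinals, i.e. its elements
reflect into the canonical nwqos of the order types in a submultiset of `E`. -/
def Dominated (L : List NestedMultiset) (E : Multiset ONote) : Prop :=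
  ∃ l : List ONote, (l : Multiset ONote) ≤ E ∧
    List.Forall₂ (fun X e => Reflects X (canon e)) L l

theorem Dominated.append {L L' : List NestedMultiset} {E E' : Multiset ONote} :
    Dominated L E → Dominated L' E' → Dominated (L ++ L') (E + E') :=
  fun ⟨l, h1, h2⟩ ⟨l', h3, h4⟩ =>
    ⟨l ++ l', by rw [← Multiset.coe_add]; exact add_le_add h1 h3, List.rel_append h2 h4⟩

theorem Dominated.map {L : List NestedMultiset} {E : Multiset ONote}
    {f : NestedMultiset → NestedMultiset} {φ : ONote → ONote}
    (hf : ∀ X e, Reflects X (canon e) → Reflects (f X) (canon (φ e))) :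
    Dominated L E → Dominated (L.map f) (E.map φ) := by
  rintro ⟨l, h1, h2⟩
  refine ⟨l.map φ, by rw [← Multiset.map_coe]; exact Multiset.map_le_map h1, ?_⟩
  rw [List.forall₂_map_left_iff, List.forall₂_map_right_iff]
  exact h2.imp hf

theorem Dominated.reflects {L : List NestedMultiset} {a : ONote}
    (h : Dominated L (ONote.terms a)) : Reflects (sumList (L.map mset)) (canon a) := by
  obtain ⟨l, h1, h2⟩ := h
  refine (reflects_sumList_of_forall₂ ?_).trans (canonList_reflects_canon_of_le h1)
  rw [List.forall₂_map_left_iff, List.forall₂_map_right_iff]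
  exact h2.imp fun _ _ => Reflects.mset

theorem normSum_lefts_le {A B : NestedMultiset} (a : Multiset (A.Carrier ⊕ B.Carrier)) :
    normSum A.norm (lefts a) ≤ normSum (sum A B).norm a :=
  (Nat.le_add_right _ _).trans_eq (Multiset.normSum_sum A.norm B.norm a).symm

theorem normSum_rights_le {A B : NestedMultiset} (a : Multiset (A.Carrier ⊕ B.Carrier)) :
    normSum B.norm (rights a) ≤ normSum (sum A B).norm a :=
  (Nat.le_add_left _ _).trans_eq (Multiset.normSum_sum A.norm B.norm a).symm

theorem dominated_residualList (n : ℕ) : ∀ (A : NestedMultiset) (a : Multiset A.Carrier),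
    normSum A.norm a ≤ n → Dominated (residualList n A a)
      (ONote.terms (ONote.expDeriv n A.orderType.1))
  | empty, _, _ => ⟨[], by simp, List.Forall₂.nil⟩
  | sum A B, a, h => by
    rw [show (sum A B).orderType.1 = ONote.natSum A.orderType.1 B.orderType.1 from rfl,
      ONote.terms_expDeriv_natSum n A.orderType.2 B.orderType.2]
    refine ((dominated_residualList n A (lefts a) ((normSum_lefts_le a).trans h)).map ?_).append
      ((dominated_residualList n B (rights a) ((normSum_rights_le a).trans h)).map ?_)
    · intro X e hX
      refine Reflects.trans ?_ (reflects_canon_natSum (reflects_canon_orderType B) hX)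
      refine ⟨Sum.swap, ?_, ?_⟩
      · rintro (x | x) (y | y) (h | h)
        · exact Sum.LiftRel.inl h
        · exact Sum.LiftRel.inr h
      · rintro (x | x) <;> exact le_rfl
    · intro X e hX
      exact reflects_canon_natSum (reflects_canon_orderType A) hX
  | mset B, a, h => by
    change Multiset (Multiset B.Carrier) at a
    have hη := B.orderType.2
    set η := B.orderType.1 with hη'
    have hterms : ONote.terms (ONote.expDeriv n (mset B).orderType.1) =
        Multiset.replicate n (ONote.termDeriv n η) := by
      have h1 : ONote.NF (ONote.oadd η 1 0) := ONote.NF.oadd_zero _ _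
      rw [show (mset B).orderType.1 = ONote.oadd η 1 0 from rfl, ONote.terms_expDeriv n h1]
      have h2 : ONote.derivExponent n (ONote.oadd η 1 0) η = ONote.termDeriv n η := by
        apply ONote.terms_inj (ONote.derivExponent_nf n h1 hη) (ONote.termDeriv_below n hη).nf
        simp
      simp [h2]
    rw [hterms]
    refine ⟨List.replicate (Multiset.card a) (ONote.termDeriv n η), ?_, ?_⟩
    · rw [Multiset.coe_replicate]
      exact Multiset.replicate_le_replicate _ |>.2 ((Multiset.card_le_normSum _ a).trans h)
    · have hlen : List.replicate (Multiset.card a) (ONote.termDeriv n η) =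
          a.toList.map fun _ => ONote.termDeriv n η := by
        rw [List.map_const', Multiset.length_toList]
      rw [hlen]
      change List.Forall₂ _ (a.toList.map fun b => _) _
      rw [List.forall₂_map_left_iff, List.forall₂_map_right_iff, List.forall₂_same]
      intro b hb
      rw [Multiset.mem_toList] at hb
      exact reflects_canon_natSum (reflects_canon_natMul (reflects_canon_orderType B) _)
        (dominated_residualList n B b ((Multiset.le_normSum_of_mem _ hb).trans h)).reflects

theorem residual_reflects_canon (n : ℕ) : ∀ (A : NestedMultiset) (a : A.Carrier),
    A.norm a ≤ n → ∃ α' ∈ ONote.derivList n A.orderType.1,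
      Reflects (A.residual n a) (canon α')
  | empty, a, _ => a.elim
  | mset A, a, h => by
    refine ⟨ONote.expDeriv n A.orderType.1, ?_, (dominated_residualList n A a h).reflects⟩
    have h1 : ONote.NF (ONote.oadd A.orderType.1 1 0) := (mset A).orderType.2
    refine (ONote.mem_derivList n h1).2 ⟨_, ONote.head_mem_terms _ _ _, ?_⟩
    apply ONote.terms_inj (ONote.expDeriv_nf n A.orderType.2)
      (ONote.natSum_nf (ONote.eraseTerm_nf h1 _) (ONote.expDeriv_nf n A.orderType.2))
    simp
  | sum A B, a, h => by
    have hA := A.orderType.2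
    have hB := B.orderType.2
    have hAB := ONote.natSum_nf hA hB
    have key : ∀ e ∈ ONote.terms A.orderType.1 + ONote.terms B.orderType.1,
        ONote.natSum (ONote.eraseTerm (ONote.natSum A.orderType.1 B.orderType.1) e)
          (ONote.expDeriv n e) ∈ ONote.derivList n (sum A B).orderType.1 := by
      intro e he
      exact (ONote.mem_derivList n hAB).2 ⟨e, by simpa using he, rfl⟩
    rcases a with a | a
    · obtain ⟨α', hα', hr⟩ := residual_reflects_canon n A a h
      obtain ⟨e, he, rfl⟩ := (ONote.mem_derivList n hA).1 hα'
      have hen := ONote.expDeriv_nf n (hA.mem_terms he)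
      refine ⟨_, key e (by simp [he]), ?_⟩
      have hr' := reflects_canon_natSum hr (reflects_canon_orderType B)
      refine Eq.subst (motive := fun x => Reflects _ (canon x)) (Eq.symm ?_) hr'
      apply ONote.terms_inj (ONote.natSum_nf (ONote.eraseTerm_nf hAB e) hen)
        (ONote.natSum_nf (ONote.natSum_nf (ONote.eraseTerm_nf hA e) hen) hB)
      simp only [ONote.terms_natSum, ONote.terms_eraseTerm, Multiset.erase_add_left_pos _ he]
      abel
    · obtain ⟨α', hα', hr⟩ := residual_reflects_canon n B a h
      obtain ⟨e, he, rfl⟩ := (ONote.mem_derivList n hB).1 hα'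
      have hen := ONote.expDeriv_nf n (hB.mem_terms he)
      refine ⟨_, key e (by simp [he]), ?_⟩
      have hr' := reflects_canon_natSum (reflects_canon_orderType A) hr
      refine Eq.subst (motive := fun x => Reflects _ (canon x)) (Eq.symm ?_) hr'
      apply ONote.terms_inj (ONote.natSum_nf (ONote.eraseTerm_nf hAB e) hen)
        (ONote.natSum_nf hA (ONote.natSum_nf (ONote.eraseTerm_nf hB e) hen))
      simp only [ONote.terms_natSum, ONote.terms_eraseTerm, Multiset.erase_add_right_pos _ he]
      abel

end NestedMultiset

/-! ### Residuals -/

namespace NestedMultiset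

open Multiset (Embeds normSum lefts rights)

open Classical in
theorem ReflectsInto.union {A B C : NestedMultiset} {S T : Set A.Carrier} :
    ReflectsInto S B → ReflectsInto T C → ReflectsInto (S ∪ T) (sum B C) := by
  rintro ⟨r, h1, h2⟩ ⟨s, h3, h4⟩
  let f : ↥(S ∪ T) → B.Carrier ⊕ C.Carrier := fun x =>
    if h : x.1 ∈ S then Sum.inl (r ⟨x.1, h⟩) else Sum.inr (s ⟨x.1, x.2.resolve_left h⟩)
  refine ⟨f, ?_, ?_⟩
  · intro x y h
    change Sum.LiftRel B.le C.le (f x) (f y) at h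
    simp only [f] at h
    split_ifs at h with hx hy hy
    · cases h
      exact h1 ⟨x.1, hx⟩ ⟨y.1, hy⟩ (by assumption)
    · cases h
    · cases h
    · cases h
      exact h3 ⟨x.1, x.2.resolve_left hx⟩ ⟨y.1, y.2.resolve_left hy⟩ (by assumption)
  · intro x
    change Sum.elim B.norm C.norm (f x) ≤ _
    simp only [f]
    split_ifs with hx
    · exact h2 ⟨x.1, hx⟩
    · exact h4 ⟨x.1, x.2.resolve_left hx⟩

theorem ReflectsInto.exists_union {A B C : NestedMultiset} {S : Set A.Carrier} :
    ReflectsInto S (sum B C) →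
      ∃ S₁ S₂ : Set A.Carrier, S ⊆ S₁ ∪ S₂ ∧ ReflectsInto S₁ B ∧ ReflectsInto S₂ C := by
  rintro ⟨r, h1, h2⟩
  change S → B.Carrier ⊕ C.Carrier at r
  refine ⟨{x | ∃ (h : x ∈ S) (b : B.Carrier), r ⟨x, h⟩ = Sum.inl b},
    {x | ∃ (h : x ∈ S) (c : C.Carrier), r ⟨x, h⟩ = Sum.inr c}, ?_, ?_, ?_⟩
  · intro x hx
    rcases hr : r ⟨x, hx⟩ with b | c
    · exact Or.inl ⟨hx, b, hr⟩
    · exact Or.inr ⟨hx, c, hr⟩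
  · choose f hf using fun x : {x | ∃ (h : x ∈ S) (b : B.Carrier), r ⟨x, h⟩ = Sum.inl b} => x.2
    choose s hs using hf
    refine ⟨s, fun x y h => h1 ⟨x.1, f x⟩ ⟨y.1, f y⟩ ?_, fun x => ?_⟩
    · rw [hs x, hs y]
      exact Sum.LiftRel.inl h
    · have := h2 ⟨x.1, f x⟩
      rw [hs x] at this
      exact this
  · choose f hf using fun x : {x | ∃ (h : x ∈ S) (c : C.Carrier), r ⟨x, h⟩ = Sum.inr c} => x.2
    choose s hs using hf
    refine ⟨s, fun x y h => h1 ⟨x.1, f x⟩ ⟨y.1, f y⟩ ?_, fun x => ?_⟩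
    · rw [hs x, hs y]
      exact Sum.LiftRel.inr h
    · have := h2 ⟨x.1, f x⟩
      rw [hs x] at this
      exact this

theorem ReflectsInto.sumList {A : NestedMultiset} : ∀ (L : List NestedMultiset)
    (S : ℕ → Set A.Carrier), (∀ (i : ℕ) (h : i < L.length), ReflectsInto (S i) L[i]) →
      ReflectsInto {x | ∃ i < L.length, x ∈ S i} (sumList L)
  | [], _, _ => reflectsInto_of_isEmpty (by simp) _
  | B :: L, S, h => by
    have h0 := h 0 (by simp)
    have hL := ReflectsInto.sumList L (fun i => S (i + 1)) fun i hi => h (i + 1) (by simpa using hi)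
    refine (h0.union hL).mono ?_
    rintro x ⟨i, hi, hx⟩
    cases i with
    | zero => exact Or.inl hx
    | succ i => exact Or.inr ⟨i, by simpa using hi, hx⟩

/-- If multisets over `A` reflect into `∑ⱼ mset Aⱼ`, then multisets over `A + B` reflect into
`∑ⱼ mset (Aⱼ + B)`, by keeping the elements of `B` unchanged. -/
theorem ReflectsInto.lefts {A B : NestedMultiset} : ∀ (L : List NestedMultiset)
    (T : Set (Multiset A.Carrier)),
    ReflectsInto (A := mset A) T (NestedMultiset.sumList (L.map mset)) →
      ReflectsInto (A := mset (sum A B))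
        {x : Multiset (A.Carrier ⊕ B.Carrier) | Multiset.lefts x ∈ T}
        (NestedMultiset.sumList ((L.map fun X => sum X B).map mset))
  | [], T, ⟨r, _, _⟩ => reflectsInto_of_isEmpty (fun _ hx => (r ⟨_, hx⟩).elim) _
  | X :: L, T, h => by
    obtain ⟨T₁, T₂, hT, ⟨r, h1, h2⟩, hT₂⟩ := h.exists_union
    have ih := ReflectsInto.lefts (B := B) L T₂ hT₂
    refine ReflectsInto.mono (T := {x : Multiset (A.Carrier ⊕ B.Carrier) | Multiset.lefts x ∈ T₁} ∪
      {x : Multiset (A.Carrier ⊕ B.Carrier) | Multiset.lefts x ∈ T₂}) (fun x hx => hT hx)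
      (ReflectsInto.union ?_ ih)
    change T₁ → Multiset X.Carrier at r
    refine ⟨fun x => ((r ⟨_, x.2⟩).map Sum.inl + (Multiset.rights x.1).map Sum.inr :
      Multiset (X.Carrier ⊕ B.Carrier)), ?_, ?_⟩
    · intro x y hxy
      have := Multiset.embeds_sum.1 hxy
      simp only [Multiset.lefts_add, Multiset.lefts_map_inl, Multiset.lefts_map_inr, add_zero,
        Multiset.rights_add, Multiset.rights_map_inl, Multiset.rights_map_inr, zero_add] at this
      exact Multiset.embeds_sum.2 ⟨h1 ⟨_, x.2⟩ ⟨_, y.2⟩ this.1, this.2⟩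
    · intro x
      have hx := h2 ⟨_, x.2⟩
      calc normSum (Sum.elim X.norm B.norm) _ = _ := Multiset.normSum_sum _ _ _
        _ = normSum X.norm (r ⟨_, x.2⟩) + normSum B.norm (Multiset.rights x.1) := by simp
        _ ≤ normSum A.norm (Multiset.lefts x.1) + normSum B.norm (Multiset.rights x.1) :=
          Nat.add_le_add_right hx _
        _ = _ := (Multiset.normSum_sum A.norm B.norm x.1).symm

theorem ReflectsInto.rights {A B : NestedMultiset} : ∀ (L : List NestedMultiset)
    (T : Set (Multiset B.Carrier)),
    ReflectsInto (A := mset B) T (NestedMultiset.sumList (L.map mset)) →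
      ReflectsInto (A := mset (sum A B))
        {x : Multiset (A.Carrier ⊕ B.Carrier) | Multiset.rights x ∈ T}
        (NestedMultiset.sumList ((L.map fun Y => sum A Y).map mset))
  | [], T, ⟨r, _, _⟩ => reflectsInto_of_isEmpty (fun _ hx => (r ⟨_, hx⟩).elim) _
  | X :: L, T, h => by
    obtain ⟨T₁, T₂, hT, ⟨r, h1, h2⟩, hT₂⟩ := h.exists_union
    have ih := ReflectsInto.rights (A := A) L T₂ hT₂
    refine ReflectsInto.mono (T := {x : Multiset (A.Carrier ⊕ B.Carrier) | Multiset.rights x ∈ T₁} ∪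
      {x : Multiset (A.Carrier ⊕ B.Carrier) | Multiset.rights x ∈ T₂}) (fun x hx => hT hx)
      (ReflectsInto.union ?_ ih)
    change T₁ → Multiset X.Carrier at r
    refine ⟨fun x => ((Multiset.lefts x.1).map Sum.inl + (r ⟨_, x.2⟩).map Sum.inr :
      Multiset (A.Carrier ⊕ X.Carrier)), ?_, ?_⟩
    · intro x y hxy
      have := Multiset.embeds_sum.1 hxy
      simp only [Multiset.lefts_add, Multiset.lefts_map_inl, Multiset.lefts_map_inr, add_zero,
        Multiset.rights_add, Multiset.rights_map_inl, Multiset.rights_map_inr, zero_add] at this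
      exact Multiset.embeds_sum.2 ⟨this.1, h1 ⟨_, x.2⟩ ⟨_, y.2⟩ this.2⟩
    · intro x
      have hx := h2 ⟨_, x.2⟩
      calc normSum (Sum.elim A.norm X.norm) _ = _ := Multiset.normSum_sum _ _ _
        _ = normSum A.norm (Multiset.lefts x.1) + normSum X.norm (r ⟨_, x.2⟩) := by simp
        _ ≤ normSum A.norm (Multiset.lefts x.1) + normSum B.norm (Multiset.rights x.1) :=
          Nat.add_le_add_left hx _
        _ = _ := (Multiset.normSum_sum A.norm B.norm x.1).symm

/-- Packs a list of at most `m` multisets over `B` into one multiset over `B * m`, putting the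
`p`-th multiset into the `p`-th copy. -/
def pack (B : NestedMultiset) :
    (m : ℕ) → List (Multiset B.Carrier) → Multiset (copies B m).Carrier
  | 0, _ => 0
  | _ + 1, [] => 0
  | m + 1, b :: l =>
    (b.map Sum.inl + (pack B m l).map Sum.inr : Multiset (B.Carrier ⊕ (copies B m).Carrier))

theorem pack_nil (B : NestedMultiset) (m : ℕ) : pack B m [] = 0 := by
  cases m <;> rfl

theorem lefts_pack_cons (B : NestedMultiset) (m : ℕ) (b : Multiset B.Carrier)
    (l : List (Multiset B.Carrier)) :
    lefts (α := B.Carrier) (β := (copies B m).Carrier) (pack B (m + 1) (b :: l)) = b := by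
  change lefts (b.map Sum.inl + (pack B m l).map Sum.inr) = b
  simp

theorem rights_pack_cons (B : NestedMultiset) (m : ℕ) (b : Multiset B.Carrier)
    (l : List (Multiset B.Carrier)) :
    rights (α := B.Carrier) (β := (copies B m).Carrier) (pack B (m + 1) (b :: l)) = pack B m l := by
  change rights (b.map Sum.inl + (pack B m l).map Sum.inr) = pack B m l
  simp

/-- The packed list is recovered up to trailing empty multisets; these are excluded either because
all multisets are nonempty or because the lengths agree. -/
theorem embeds_of_pack {B : NestedMultiset} : ∀ {m : ℕ} {l l' : List (Multiset B.Carrier)},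
    l.length ≤ m → l'.length ≤ m → ((∀ b ∈ l, b ≠ 0) ∨ l.length = l'.length) →
      Embeds (copies B m).le (pack B m l) (pack B m l') →
        Embeds (mset B).le (l : Multiset (Multiset B.Carrier)) (l' : Multiset (Multiset B.Carrier))
  | _, [], _, _, _, _, _ => Embeds.zero _ _
  | 0, _ :: _, _, h, _, _, _ => absurd h (by simp)
  | m + 1, b :: l, [], _, _, hne, h => by
    rcases hne with hne | hne
    · rw [pack_nil] at h
      have h0 := Multiset.embeds_zero_right h
      have hb := lefts_pack_cons B m b l
      rw [h0] at hb
      exact absurd hb.symm (hne b (by simp))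
    · simp at hne
  | m + 1, b :: l, b' :: l', hl, hl', hne, h => by
    have h' := Multiset.embeds_sum.1 h
    rw [lefts_pack_cons, lefts_pack_cons, rights_pack_cons, rights_pack_cons] at h'
    have ih := embeds_of_pack (by simpa using hl) (by simpa using hl')
      (hne.imp (fun H x hx => H x (by simp [hx])) (fun H => by simpa using H)) h'.2
    rw [← Multiset.cons_coe, ← Multiset.cons_coe]
    exact Embeds.cons h'.1 ih

theorem normSum_pack_le {B : NestedMultiset} : ∀ (m : ℕ) (l : List (Multiset B.Carrier)),
    normSum (copies B m).norm (pack B m l) ≤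
      normSum (mset B).norm (l : Multiset (Multiset B.Carrier))
  | 0, _ => Nat.zero_le _
  | _ + 1, [] => Nat.zero_le _
  | m + 1, b :: l => by
    have ih := normSum_pack_le m l
    rw [← Multiset.cons_coe]
    calc normSum (Sum.elim B.norm (copies B m).norm) (pack B (m + 1) (b :: l)) = _ :=
          Multiset.normSum_sum _ _ _
      _ = normSum B.norm b + normSum (copies B m).norm (pack B m l) := by
          rw [lefts_pack_cons, rights_pack_cons]
      _ ≤ 1 + normSum B.norm b + normSum (mset B).norm (l : Multiset (Multiset B.Carrier)) := by
          omega
      _ = _ := (Multiset.normSum_cons (mset B).norm b _).symm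

/-- Multisets of multisets over `B` that consist of at most `m` arbitrary elements and further
elements of `T`, where `T` reflects into `Z`, reflect into `mset (B * m + Z)`. Since packing loses
trailing empty multisets, the arbitrary elements are nonempty or their number is fixed. -/
theorem ReflectsInto.pack {B Z : NestedMultiset} {m : ℕ} {T : Set (Multiset B.Carrier)}
    (hT : ReflectsInto (A := mset B) T Z) {S : Set (Multiset (Multiset B.Carrier))}
    (P : Multiset (Multiset B.Carrier) → Prop)
    (hP : (∀ u, P u → ∀ b ∈ u, b ≠ 0) ∨ ∃ s, ∀ u, P u → Multiset.card u = s)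
    (hS : ∀ x ∈ S, ∃ u w, x = u + w ∧ Multiset.card u ≤ m ∧ P u ∧ ∀ z ∈ w, z ∈ T) :
    ReflectsInto (A := mset (mset B)) S (mset (sum (copies B m) Z)) := by
  obtain ⟨r, h1, h2⟩ := hT
  have hS' : ∀ x : S, ∃ (l : List (Multiset B.Carrier)) (w : Multiset T),
      x.1 = (l : Multiset (Multiset B.Carrier)) + w.map Subtype.val ∧ l.length ≤ m ∧
        P (l : Multiset (Multiset B.Carrier)) := by
    rintro ⟨x, hx⟩
    obtain ⟨u, w, rfl, hu, hPu, hw⟩ := hS x hx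
    lift w to Multiset T using hw
    exact ⟨u.toList, w, by rw [Multiset.coe_toList], by rwa [Multiset.length_toList],
      by rwa [Multiset.coe_toList]⟩
  choose l w hx hl hPl using hS'
  have hnorm : ∀ x : S, normSum (mset B).norm x.1 =
      normSum (mset B).norm (l x : Multiset (Multiset B.Carrier)) +
        normSum (fun t : T => (mset B).norm t.1) (w x) := by
    intro x
    rw [hx x]
    exact (Multiset.normSum_add _ _ _).trans
      (congrArg _ (Multiset.normSum_map (mset B).norm Subtype.val (w x)))
  refine ⟨fun x => ((NestedMultiset.pack B m (l x)).map Sum.inl + ((w x).map r).map Sum.inr :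
    Multiset ((copies B m).Carrier ⊕ Z.Carrier)), ?_, ?_⟩
  · intro x y h
    have h' := Multiset.embeds_sum.1 h
    simp only [Multiset.lefts_add, Multiset.lefts_map_inl, Multiset.lefts_map_inr, add_zero,
      Multiset.rights_add, Multiset.rights_map_inl, Multiset.rights_map_inr, zero_add] at h'
    have hu := embeds_of_pack (hl x) (hl y) (hP.imp (fun H => H _ (hPl x)) (fun ⟨s, H⟩ => by
      have hx := H _ (hPl x)
      have hy := H _ (hPl y)
      simp only [Multiset.coe_card] at hx hy
      rw [hx, hy])) h'.1
    have hw : Embeds (mset B).le ((w x).map Subtype.val) ((w y).map Subtype.val) :=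
      Embeds.map (f := Subtype.val) (fun _ _ h => h) (Embeds.of_map h1 h'.2)
    change Embeds (mset B).le x.1 y.1
    rw [hx x, hx y]
    exact hu.add hw
  · intro x
    calc normSum (Sum.elim (copies B m).norm Z.norm) _ = _ := Multiset.normSum_sum _ _ _
      _ = normSum (copies B m).norm (NestedMultiset.pack B m (l x)) +
          normSum (fun t => Z.norm (r t)) (w x) := by
        simp
        exact Multiset.normSum_map _ _ _
      _ ≤ _ := add_le_add (normSum_pack_le m _) (Multiset.normSum_mono h2 _)
      _ = _ := (hnorm x).symm

open Classical in
theorem exists_getElem_countP_take {α : Type*} (p : α → Prop) : ∀ (l : List α) (j : ℕ),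
    j < l.countP p → ∃ (i : ℕ) (h : i < l.length), p l[i] ∧ (l.take i).countP p = j
  | [], j, h => absurd h (by simp)
  | a :: l, j, h => by
    by_cases ha : p a
    · cases j with
      | zero => exact ⟨0, by simp, ha, by simp⟩
      | succ j =>
        obtain ⟨i, hi, h1, h2⟩ := exists_getElem_countP_take p l j (by simpa [ha] using h)
        exact ⟨i + 1, by simpa using hi, by simpa using h1, by simp [ha, h2]⟩
    · obtain ⟨i, hi, h1, h2⟩ := exists_getElem_countP_take p l j (by simpa [ha] using h)
      exact ⟨i + 1, by simpa using hi, by simpa using h1, by simp [ha, h2]⟩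

open Classical in
/-- The residual of a multiset of multisets. If the nonempty elements of `a` do not embed into `x`,
Hall's theorem gives a nonempty `b ∈ a` such that all but at most `n - 1` elements of `x` are in the
residual of `b`. Otherwise `x` has fewer elements than `a`, and there are as many possible sizes of
`x` as there are empty elements in `a`: each size uses the summand of its own empty element. -/
theorem reflectsInto_residual_mset_mset {B : NestedMultiset} {n : ℕ}
    {a : Multiset (Multiset B.Carrier)} (ha : normSum (normSum B.norm) a ≤ n)
    (R : Multiset B.Carrier → NestedMultiset)
    (hR : ∀ b ∈ a, ReflectsInto (A := mset B) {z : Multiset B.Carrier | ¬ Embeds B.le b z} (R b)) :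
    ReflectsInto (A := mset (mset B)) {x | ¬ Embeds (Embeds B.le) a x}
      (sumList (a.toList.map fun b => mset (sum (copies B (n - 1)) (R b)))) := by
  have hcard : Multiset.card a ≤ n := (Multiset.card_le_normSum _ a).trans ha
  set L := a.toList with hL
  have hLa : (L : Multiset (Multiset B.Carrier)) = a := Multiset.coe_toList a
  have hlen : L.length = Multiset.card a := Multiset.length_toList a
  obtain ⟨p, hp⟩ : ∃ p : Multiset B.Carrier → Prop, ∀ b, p b ↔ b = 0 := ⟨_, fun _ => Iff.rfl⟩
  set a₁ : Multiset (Multiset B.Carrier) := a.filter fun b => ¬ p b with ha₁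
  have hmem₁ : ∀ b ∈ a₁, b ∈ a ∧ b ≠ 0 := fun b hb => by
    simpa [ha₁, hp] using hb
  have hsplit : Multiset.card a = a₁.card + L.countP p := by
    rw [ha₁, ← Multiset.coe_countP, hLa, ← Multiset.countP_eq_card_filter]
    have := Multiset.card_eq_countP_add_countP p a
    omega
  -- the multisets that are sent to the `i`-th summand
  let S : ℕ → Set (Multiset (Multiset B.Carrier)) := fun i =>
    {x | ∃ h : i < L.length,
      (L[i] ≠ 0 ∧ ∃ u w, x = u + w ∧ u.card ≤ n - 1 ∧ (∀ b ∈ u, b ≠ 0) ∧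
        ∀ z ∈ w, ¬ Embeds B.le L[i] z) ∨
      L[i] = 0 ∧ x.card = a₁.card + (L.take i).countP p ∧
        x.card < a.card}
  refine (ReflectsInto.sumList (A := mset (mset B)) _ S ?_).mono ?_
  · intro i hi
    have hi' : i < L.length := by simpa using hi
    have hmem : L[i] ∈ a := by
      rw [← Multiset.mem_toList]
      exact List.getElem_mem hi'
    rw [List.getElem_map]
    by_cases h0 : L[i] = 0
    · refine ReflectsInto.pack (hR _ hmem)
        (fun u => u.card = a₁.card + (L.take i).countP p)
        (Or.inr ⟨_, fun _ h => h⟩) ?_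
      rintro x ⟨_, ⟨h, _⟩ | ⟨_, h1, h2⟩⟩
      · exact absurd h0 h
      · exact ⟨x, 0, (add_zero x).symm, by omega, h1, by simp⟩
    · refine ReflectsInto.pack (hR _ hmem) (fun u => ∀ b ∈ u, b ≠ 0) (Or.inl fun _ h => h) ?_
      rintro x ⟨_, ⟨_, h⟩ | ⟨h, _⟩⟩
      · obtain ⟨u, w, h1, h2, h3, h4⟩ := h
        exact ⟨u, w, h1, h2, h3, h4⟩
      · exact absurd h h0
  · intro (x : Multiset (Multiset B.Carrier)) hx
    change ¬ Embeds (Embeds B.le) a x at hx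
    change ∃ i < (List.map _ L).length, x ∈ S i
    rw [List.length_map]
    by_cases hne : Embeds (Embeds B.le) a₁ x
    · -- the remaining elements of `a` are empty, so that `x` is too small
      obtain ⟨m₀, h0, hr⟩ := hne
      have hx' := tsub_add_cancel_of_le h0
      have hm₀ := Multiset.card_eq_card_of_rel hr
      have hcx : x.card = (x - m₀).card + m₀.card := by
        rw [← Multiset.card_add, hx']
      have hsmall : x.card < a.card := by
        by_contra hge
        apply hx
        rw [← hx', ← Multiset.filter_add_not p a]
        refine Embeds.add (Embeds.of_card_le ?_ ?_) ⟨m₀, le_rfl, hr⟩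
        · intro b hb z
          have hb0 : b = 0 := (hp b).1 (Multiset.mem_filter.1 hb).2
          rw [hb0]
          exact Embeds.zero _ _
        · have := congrArg Multiset.card (Multiset.filter_add_not p a)
          rw [Multiset.card_add, ← ha₁] at this
          omega
      obtain ⟨i, hi, h1, h2⟩ := exists_getElem_countP_take p L
        (x.card - a₁.card) (by omega)
      exact ⟨i, hi, hi, Or.inr ⟨(hp _).1 h1, by omega, hsmall⟩⟩
    · obtain ⟨b, hb, u, w, hxuw, hu, hu', hw⟩ := Multiset.exists_decomposition_of_not_embeds hne
      obtain ⟨hba, hb0⟩ := hmem₁ b hb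
      rw [← Multiset.mem_toList] at hba
      obtain ⟨i, hi, rfl⟩ := List.getElem_of_mem hba
      have := Multiset.card_le_card (Multiset.filter_le (fun b => ¬ p b) a)
      refine ⟨i, hi, hi, Or.inl ⟨hb0, u, w, hxuw, by omega, ?_, hw⟩⟩
      rintro z hz rfl
      obtain ⟨b', hb', h⟩ := hu' 0 hz
      exact (hmem₁ b' hb').2 (Multiset.embeds_zero_right h)

theorem reflectsInto_residualList (n : ℕ) : ∀ (A : NestedMultiset) (a : Multiset A.Carrier),
    normSum A.norm a ≤ n → ReflectsInto (A := mset A) {x : Multiset A.Carrier | ¬ Embeds A.le a x}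
      (sumList ((residualList n A a).map mset))
  | empty, a, _ => by
    refine reflectsInto_of_isEmpty ?_ _
    intro (x : Multiset empty.Carrier) (hx : ¬ Embeds _ a x)
    apply hx
    have ha : a = 0 := Multiset.eq_zero_of_forall_notMem fun b => Empty.elim b
    rw [ha]
    exact Embeds.zero _ _
  | sum A B, a, h => by
    have hA := reflectsInto_residualList n A (lefts a) ((normSum_lefts_le a).trans h)
    have hB := reflectsInto_residualList n B (rights a) ((normSum_rights_le a).trans h)
    have := ((ReflectsInto.lefts (B := B) _ _ hA).union
      (ReflectsInto.rights (A := A) _ _ hB)).trans (reflects_sumList_append _ _)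
    rw [← List.map_append] at this
    refine this.mono ?_
    intro (x : Multiset (A.Carrier ⊕ B.Carrier)) hx
    by_contra hcon
    obtain ⟨h1, h2⟩ := not_or.1 hcon
    exact hx (Multiset.embeds_sum.2 ⟨not_not.1 h1, not_not.1 h2⟩)
  | mset B, a, h => by
    have := reflectsInto_residual_mset_mset h (fun b => sumList ((residualList n B b).map mset))
      fun b hb => reflectsInto_residualList n B b ((Multiset.le_normSum_of_mem _ hb).trans h)
    rw [residualList, List.map_map]
    exact this

theorem reflectsInto_residual (n : ℕ) : ∀ (A : NestedMultiset) (a : A.Carrier), A.norm a ≤ n →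
    ReflectsInto {x : A.Carrier | ¬ A.le a x} (A.residual n a)
  | empty, a, _ => a.elim
  | mset A, a, h => reflectsInto_residualList n A a h
  | sum A B, a, h => by
    rcases a with a | a
    · obtain ⟨r, h1, h2⟩ := reflectsInto_residual n A a h
      refine ⟨fun x => match x with
        | ⟨Sum.inl x, hx⟩ => Sum.inl (r ⟨x, fun h => hx (Sum.LiftRel.inl h)⟩)
        | ⟨Sum.inr x, _⟩ => Sum.inr x, ?_, ?_⟩
      · rintro ⟨x | x, hx⟩ ⟨y | y, hy⟩ (h | h)
        · exact Sum.LiftRel.inl (h1 _ _ h)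
        · exact Sum.LiftRel.inr h
      · rintro ⟨x | x, hx⟩
        · exact h2 ⟨x, _⟩
        · exact le_rfl
    · obtain ⟨r, h1, h2⟩ := reflectsInto_residual n B a h
      refine ⟨fun x => match x with
        | ⟨Sum.inl x, _⟩ => Sum.inl x
        | ⟨Sum.inr x, hx⟩ => Sum.inr (r ⟨x, fun h => hx (Sum.LiftRel.inr h)⟩), ?_, ?_⟩
      · rintro ⟨x | x, hx⟩ ⟨y | y, hy⟩ (h | h)
        · exact Sum.LiftRel.inl h
        · exact Sum.LiftRel.inr (h1 _ _ h)
      · rintro ⟨x | x, hx⟩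
        · exact le_rfl
        · exact h2 ⟨x, _⟩

/-! ### Controlled bad sequences -/

theorem ReflectsInto.mem_badLengths {A B : NestedMultiset} {S : Set A.Carrier}
    (h : ReflectsInto S B) {g : ℕ → ℕ} {n L : ℕ} {s : Fin L → A.Carrier} (hs : ∀ i, s i ∈ S)
    (hbad : A.IsBad s) (hc : A.IsControlled g n s) : L ∈ B.badLengths g n := by
  obtain ⟨r, h1, h2⟩ := h
  exact ⟨fun i => r ⟨s i, hs i⟩, fun i j hij hle => hbad i j hij (h1 _ _ hle),
    fun i => (h2 _).trans (hc i)⟩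

/-- Descent: the tail of a bad sequence lies in the residual of its first element. -/
theorem le_maxLen_of_mem_badLengths (g : ℕ → ℕ) (α : NONote) : ∀ {A : NestedMultiset} {n L : ℕ},
    A.orderType = α → L ∈ A.badLengths g n → L ≤ NONote.maxLen g α n := by
  intro A n L hα hL
  obtain ⟨s, hbad, hc⟩ := hL
  cases L with
  | zero => exact Nat.zero_le _
  | succ L =>
    have h0 : A.norm (s 0) ≤ n := hc 0
    obtain ⟨α', hα', hr⟩ := residual_reflects_canon n A (s 0) h0
    rw [hα] at hα'
    have hnf := (ONote.derivList_spec n α.2 α' hα').1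
    have hmem : (⟨α', hnf⟩ : NONote) ∈ NONote.deriv n α := NONote.mem_deriv.2 hα'
    have hlt := NONote.lt_of_mem_deriv hmem
    have htail : L ∈ (canon α').badLengths g (g n) := by
      refine ((reflectsInto_residual n A (s 0) h0).trans hr).mem_badLengths
        (s := fun i : Fin L => s i.succ) (fun i => hbad 0 i.succ (Fin.succ_pos i)) ?_ ?_
      · exact fun i j hij => hbad i.succ j.succ (Fin.succ_lt_succ_iff.2 hij)
      · intro i
        have := hc i.succ
        rwa [Fin.val_succ, Function.iterate_succ_apply] at this
    have ih := le_maxLen_of_mem_badLengths g ⟨α', hnf⟩ (A := canon α')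
      (Subtype.ext (orderType_canon hnf)) htail
    have := NONote.succ_maxLen_le (g := g) hmem
    omega
termination_by α

theorem isGreatest_lengthFun (A : NestedMultiset) (g : ℕ → ℕ) (n : ℕ) :
    IsGreatest (A.badLengths g n) (A.lengthFun g n) := by
  have hne : (A.badLengths g n).Nonempty := ⟨0, Fin.elim0, fun i => i.elim0, fun i => i.elim0⟩
  have hbdd : BddAbove (A.badLengths g n) :=
    ⟨_, fun _ hL => le_maxLen_of_mem_badLengths g A.orderType rfl hL⟩
  exact ⟨Nat.sSup_mem hne hbdd, fun _ hL => le_csSup hbdd hL⟩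

theorem lengthFun_le_maxLen (A : NestedMultiset) (g : ℕ → ℕ) (n : ℕ) :
    A.lengthFun g n ≤ NONote.maxLen g A.orderType n :=
  le_maxLen_of_mem_badLengths g A.orderType rfl (isGreatest_lengthFun A g n).1

end NestedMultiset

/-! ### The Hardy hierarchy -/

namespace ONote

/-- The Hardy hierarchy over `h`: `h^α(x)` iterates `h` on `x` as often as `h_α(x)` counts. -/
def hardy (h : ℕ → ℕ) (a : ONote) (x : ℕ) : ℕ := h^[cichon h a x] x

@[simp] theorem hardy_zero (h : ℕ → ℕ) (x : ℕ) : hardy h 0 x = x := by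
  simp [hardy]

theorem hardy_succ (h : ℕ → ℕ) {a : ONote} (ha : isSucc a = true) (x : ℕ) :
    hardy h a x = hardy h (fundSeq a x) (h x) := by
  rw [hardy, cichon_succ h ha, Nat.add_comm, Function.iterate_succ_apply, hardy]

theorem hardy_limit (h : ℕ → ℕ) {a : ONote} (ha : isSucc a = false) (x : ℕ) :
    hardy h a x = hardy h (fundSeq a x) x := by
  rw [hardy, cichon_limit h ha, hardy]

theorem hardy_one (h : ℕ → ℕ) (x : ℕ) : hardy h (oadd 0 1 0) x = h x := by
  rw [hardy_succ h (by simp [isSucc_oadd_zero]), fundSeq_one, hardy_zero]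

theorem hardy_oadd (h : ℕ → ℕ) (e : ONote) (c : ℕ+) (a : ONote) (x : ℕ) :
    hardy h (oadd e c a) x = hardy h (oadd e c 0) (hardy h a x) := by
  by_cases h0 : a = 0
  · rw [h0, hardy_zero]
  · have := fundSeq_lt a x h0
    cases hs : isSucc a
    · rw [hardy_limit h ((isSucc_oadd h0 e c).trans hs), fundSeq_oadd h0, hardy_limit h hs,
        hardy_oadd h e c (fundSeq a x)]
    · rw [hardy_succ h ((isSucc_oadd h0 e c).trans hs), fundSeq_oadd h0, hardy_succ h hs,
        hardy_oadd h e c (fundSeq a x)]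
termination_by a

theorem hardy_consTerm (h : ℕ → ℕ) (e : ONote) : ∀ (c x : ℕ),
    hardy h (consTerm e c 0) x = (hardy h (oadd e 1 0))^[c] x
  | 0, x => by simp
  | c + 1, x => by
    rw [Function.iterate_succ_apply, ← hardy_consTerm h e c]
    have hf : fundSeq (consTerm e (c + 1) 0) x = consTerm e c (fundSeq (oadd e 1 0) x) := by
      rw [consTerm_succ, fundSeq_oadd_zero]
      simp
    have hc : ∀ (t : ONote) (y : ℕ),
        hardy h (consTerm e c t) y = hardy h (consTerm e c 0) (hardy h t y) := by
      intro t y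
      cases c with
      | zero => simp
      | succ c => rw [consTerm_succ, consTerm_succ, hardy_oadd]
    by_cases he : e = 0
    · subst he
      rw [hardy_succ h (by rw [consTerm_succ, isSucc_oadd_zero]; simp), hf, hc, fundSeq_one,
        hardy_zero, hardy_one]
    · rw [hardy_limit h (by rw [consTerm_succ, isSucc_oadd_zero]; simp [he]), hf, hc,
        hardy_limit h (a := oadd e 1 0) (by simp [isSucc_oadd_zero, he])]

theorem hardy_oadd_eq_iterate (h : ℕ → ℕ) (e : ONote) (c : ℕ+) (a : ONote) (x : ℕ) :
    hardy h (oadd e c a) x = (hardy h (oadd e 1 0))^[c] (hardy h a x) := by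
  rw [hardy_oadd, ← hardy_consTerm]
  congr 1
  rw [consTerm, dif_pos c.pos]
  rfl

theorem hardy_opow_succ (h : ℕ → ℕ) {e : ONote} (he : isSucc e = true) (x : ℕ) :
    hardy h (oadd e 1 0) x = (hardy h (oadd (fundSeq e x) 1 0))^[x] x := by
  rw [hardy_limit h (by simp [isSucc_oadd_zero, ne_zero_of_isSucc he]), fundSeq_opow_succ he,
    hardy_consTerm]

theorem hardy_opow_limit (h : ℕ → ℕ) {e : ONote} (h0 : e ≠ 0) (he : isSucc e = false) (x : ℕ) :
    hardy h (oadd e 1 0) x = hardy h (oadd (fundSeq e x) 1 0) x := by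
  rw [hardy_limit h (by simp [isSucc_oadd_zero, h0]), fundSeq_opow_limit h0 he]

theorem Descends.hardy_le {h : ℕ → ℕ} (hm : Monotone h) (hx : ∀ x, x ≤ h x) {a b : ONote} {x : ℕ}
    (hab : Descends x a b) : hardy h b x ≤ hardy h a x :=
  Function.monotone_iterate_of_id_le hx (hab.cichon_le hm hx) x

theorem add_cichon_le_hardy {h : ℕ → ℕ} (hx : ∀ x, x < h x) (a : ONote) (x : ℕ) :
    x + cichon h a x ≤ hardy h a x := by
  have : ∀ c y, y + c ≤ h^[c] y := by
    intro c
    induction c with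
    | zero => simp
    | succ c ih =>
      intro y
      rw [Function.iterate_succ_apply]
      have := ih (h y)
      have := hx y
      omega
  exact this _ _

theorem cichon_le_cichon {g h : ℕ → ℕ} (hm : Monotone h) (hx : ∀ x, x ≤ h x)
    (hgh : ∀ x, g x ≤ h x) (a : ONote) (x : ℕ) : cichon g a x ≤ cichon h a x := by
  by_cases h0 : a = 0
  · simp [h0]
  · have := fundSeq_lt a x h0
    cases hs : isSucc a
    · rw [cichon_limit g hs, cichon_limit h hs]
      exact cichon_le_cichon hm hx hgh _ _
    · rw [cichon_succ g hs, cichon_succ h hs]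
      exact Nat.add_le_add_left ((cichon_le_cichon hm hx hgh _ _).trans
        (cichon_mono hm hx _ (hgh x))) _
termination_by a

/-! ### The fast-growing hierarchy -/

@[simp] theorem fastGrow_zero (x : ℕ) : fastGrow 0 x = x + 1 := by
  rw [fastGrow, dif_pos rfl]

theorem fastGrow_succ {a : ONote} (ha : isSucc a = true) (x : ℕ) :
    fastGrow a x = (fastGrow (fundSeq a x))^[x] x := by
  rw [fastGrow, dif_neg (ne_zero_of_isSucc ha), if_pos ha]

theorem fastGrow_limit {a : ONote} (ha : isSucc a = false) (x : ℕ) :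
    fastGrow a x = fastGrow (fundSeq a x) x := by
  by_cases h0 : a = 0
  · rw [h0, fundSeq_zero]
  · rw [fastGrow, dif_neg h0, if_neg (by simp [ha])]

theorem fastGrow_mono_aux (a : ONote) :
    (∀ x, x ≤ fastGrow a x) ∧ (∀ x y, x ≤ y → fastGrow a x ≤ fastGrow a y) ∧
      ∀ x b, 1 ≤ x → Descends x a b → fastGrow b x ≤ fastGrow a x := by
  by_cases h0 : a = 0
  · subst h0
    refine ⟨fun x => by simp, fun x y h => by simpa using h, fun x b _ hb => ?_⟩
    have : b = 0 := by
      induction hb with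
      | refl => rfl
      | tail _ hbc ih => rw [hbc, ih, fundSeq_zero]
    rw [this]
  · have hinf : ∀ x, x ≤ fastGrow a x := by
      intro x
      have := fundSeq_lt a x h0
      have ih := (fastGrow_mono_aux (fundSeq a x)).1
      cases hs : isSucc a
      · rw [fastGrow_limit hs]
        exact ih x
      · rw [fastGrow_succ hs]
        exact Function.id_le_iterate_of_id_le ih x x
    refine ⟨hinf, fun x y hxy => ?_, fun x b hx hb => ?_⟩
    · have := fundSeq_lt a x h0
      have := fundSeq_lt a y h0
      have ihx := fastGrow_mono_aux (fundSeq a x)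
      have ihy := fastGrow_mono_aux (fundSeq a y)
      cases hs : isSucc a
      · rcases hxy.eq_or_lt with rfl | hlt
        · rfl
        · rw [fastGrow_limit hs, fastGrow_limit hs]
          exact (ihx.2.1 x y hxy).trans
            (ihy.2.2 y _ (by omega) (Descends.fundSeq_of_le hxy (by omega) hs))
      · rw [fastGrow_succ hs, fastGrow_succ hs, fundSeq_congr_of_isSucc hs x y]
        exact (Function.monotone_iterate_of_id_le ihy.1 hxy x).trans
          (Monotone.iterate (fun _ _ h => ihy.2.1 _ _ h) y hxy)
    · have := fundSeq_lt a x h0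
      have ih := fastGrow_mono_aux (fundSeq a x)
      rcases hb.eq_or_step with rfl | hb
      · rfl
      · refine (ih.2.2 x b hx hb).trans ?_
        cases hs : isSucc a
        · rw [fastGrow_limit hs]
        · rw [fastGrow_succ hs]
          exact Function.monotone_iterate_of_id_le ih.1 hx x
termination_by a

theorem le_fastGrow (a : ONote) (x : ℕ) : x ≤ fastGrow a x := (fastGrow_mono_aux a).1 x

theorem fastGrow_mono (a : ONote) : Monotone (fastGrow a) :=
  fun x y => (fastGrow_mono_aux a).2.1 x y

theorem Descends.fastGrow_le {a b : ONote} {x : ℕ} (hx : 1 ≤ x) (h : Descends x a b) :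
    fastGrow b x ≤ fastGrow a x := (fastGrow_mono_aux a).2.2 x b hx h

theorem isSucc_ofNat (m : ℕ) : isSucc (ofNat (m + 1)) = true := by
  rw [ofNat_succ, isSucc_oadd_zero]
  rfl

theorem fundSeq_ofNat (m x : ℕ) : fundSeq (ofNat (m + 1)) x = ofNat m := by
  rw [ofNat_succ, fundSeq_oadd_zero, fundSeq_one]
  cases m with
  | zero => simp
  | succ m =>
    rw [ofNat_succ, ← consTerm_succ]
    simp

theorem ack_eq_iterate (m : ℕ) : ∀ n, ack (m + 1) n = (ack m)^[n + 1] 1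
  | 0 => by simp
  | n + 1 => by rw [ack_succ_succ, ack_eq_iterate m n, Function.iterate_succ_apply' _ (n + 1)]

theorem iterate_add_le {f F : ℕ → ℕ} {c : ℕ} (hF : Monotone F) (h : ∀ x, f x + c ≤ F (x + c)) :
    ∀ j x, f^[j] x + c ≤ F^[j] (x + c)
  | 0, _ => le_rfl
  | j + 1, x => by
    rw [Function.iterate_succ_apply', Function.iterate_succ_apply']
    exact (h _).trans (hF (iterate_add_le hF h j x))

theorem ack_add_two_le_fastGrow : ∀ m n, ack m n + 2 ≤ fastGrow (ofNat m) (n + 2)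
  | 0, n => by
    rw [ofNat_zero, fastGrow_zero, ack_zero]
  | m + 1, n => by
    have ih := ack_add_two_le_fastGrow m
    have h0 : n + 2 + 1 ≤ fastGrow (ofNat m) (n + 2) := by
      rw [← fastGrow_zero]
      exact (Descends.zero (n + 2) (ofNat m)).fastGrow_le (by omega)
    rw [fastGrow_succ (isSucc_ofNat m), fundSeq_ofNat, ack_eq_iterate,
      Function.iterate_succ_apply (fastGrow _)]
    refine (iterate_add_le (fastGrow_mono _) ih _ _).trans ?_
    exact (fastGrow_mono _).iterate _ (by omega)

theorem ack_add_le_fastGrow {m c : ℕ} (hc : 2 ≤ c) (x : ℕ) :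
    ack m x + c ≤ fastGrow (ofNat m) (x + c) := by
  obtain ⟨d, rfl⟩ := Nat.exists_eq_add_of_le' hc
  have h : ∀ d, ack m x + d ≤ ack m (x + d) := by
    intro d
    induction d with
    | zero => rfl
    | succ d ih => exact Nat.lt_of_le_of_lt ih (ack_strictMono_right m (Nat.lt_succ_self (x + d)))
  have := h d
  have := ack_add_two_le_fastGrow m (x + d)
  change ack m x + (d + 2) ≤ fastGrow (ofNat m) (x + d + 2)
  omega

/-- One level up in the comparison of the Hardy hierarchy with the fast-growing hierarchy. -/
theorem hardy_opow_add_le_succ {h : ℕ → ℕ} {c : ℕ} {a b : ONote} (ha : isSucc a = true)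
    (hb : isSucc b = true)
    (ih : ∀ x, hardy h (oadd (fundSeq a 0) 1 0) x + c ≤ fastGrow (fundSeq b 0) (x + c)) (x : ℕ) :
    hardy h (oadd a 1 0) x + c ≤ fastGrow b (x + c) := by
  rw [hardy_opow_succ h ha, fastGrow_succ hb, fundSeq_congr_of_isSucc ha x 0,
    fundSeq_congr_of_isSucc hb (x + c) 0]
  exact (iterate_add_le (fastGrow_mono _) ih x x).trans
    (Function.monotone_iterate_of_id_le (le_fastGrow _) (Nat.le_add_right x c) _)

theorem hardy_opow_ofNat_add_le {m c : ℕ} (hc : 2 ≤ c) : ∀ j x,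
    hardy (ack m) (oadd (ofNat j) 1 0) x + c ≤ fastGrow (ofNat (m + j)) (x + c)
  | 0, x => by
    rw [ofNat_zero, hardy_one]
    exact ack_add_le_fastGrow hc x
  | j + 1, x => by
    refine hardy_opow_add_le_succ (isSucc_ofNat j) (isSucc_ofNat (m + j)) ?_ x
    rw [fundSeq_ofNat, fundSeq_ofNat]
    exact hardy_opow_ofNat_add_le hc j

theorem omega0_le_repr_oadd {e : ONote} (he : e ≠ 0) (c : ℕ+) (a : ONote) :
    Ordinal.omega0 ≤ repr (oadd e c a) := by
  refine le_trans ?_ (omega0_le_oadd e c a)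
  conv_lhs => rw [← Ordinal.opow_one Ordinal.omega0]
  exact Ordinal.opow_le_opow_right Ordinal.omega0_pos
    (Order.one_le_iff_pos.2 (by simpa using lt_def.1 (pos_of_ne_zero he)))

/-- Finite elements of fundamental sequences are small. -/
theorem repr_fundSeq_le {e : ONote} (he : NF e) (h0 : e ≠ 0) (hs : isSucc e = false) {x : ℕ}
    (hlt : repr (fundSeq e x) < Ordinal.omega0) : repr (fundSeq e x) ≤ ((x + 1 : ℕ) : Ordinal) := by
  obtain _ | ⟨e, c, a⟩ := e
  · exact absurd rfl h0
  by_cases ha : a = 0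
  · subst ha
    rw [isSucc_oadd_zero, decide_eq_false_iff_not] at hs
    rw [fundSeq_oadd_zero] at hlt ⊢
    by_cases hc : (c : ℕ) - 1 = 0
    · rw [hc, consTerm_zero] at hlt ⊢
      cases hse : isSucc e
      · rw [fundSeq_opow_limit hs hse] at hlt ⊢
        by_cases hf : fundSeq e x = 0
        · simp [hf, repr]
        · exact absurd (omega0_le_repr_oadd hf _ _) hlt.not_ge
      · rw [fundSeq_opow_succ hse] at hlt ⊢
        cases x with
        | zero => simp
        | succ x =>
          rw [consTerm_succ] at hlt ⊢
          by_cases hf : fundSeq e (x + 1) = 0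
          · rw [hf]
            simp only [repr, Ordinal.opow_zero, one_mul, add_zero, Nat.succPNat_coe]
            exact_mod_cast Nat.le_succ _
          · exact absurd (omega0_le_repr_oadd hf _ _) hlt.not_ge
    · obtain ⟨d, hd⟩ := Nat.exists_eq_succ_of_ne_zero hc
      rw [hd, Nat.succ_eq_add_one, consTerm_succ] at hlt
      exact absurd (omega0_le_repr_oadd hs _ _) hlt.not_ge
  · rw [fundSeq_oadd ha] at hlt
    have h1 : e ≠ 0 := fun h => ha (he.zero_of_zero h)
    exact absurd (omega0_le_repr_oadd h1 _ _) hlt.not_ge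

theorem isLean_ofNat : ∀ m, IsLean m (ofNat m)
  | 0 => trivial
  | m + 1 => ⟨trivial, le_of_eq (Nat.succPNat_coe m), trivial⟩

/-- From level `ω` on, passing from the successor to the Ackermann function `ack m` as base function
is absorbed by a constant shift of the argument. -/
theorem hardy_opow_add_le_fastGrow (m : ℕ) (e : ONote) (he : NF e)
    (hω : Ordinal.omega0 ≤ repr e) (x : ℕ) :
    hardy (ack m) (oadd e 1 0) x + (m + 2) ≤ fastGrow e (x + (m + 2)) := by
  have h0 : e ≠ 0 := by
    rintro rfl
    exact absurd hω (by simp)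
  cases hs : isSucc e
  · have hlt := fundSeq_lt e x h0
    have hnf := fundSeq_nf he x
    rw [hardy_opow_limit _ h0 hs]
    rcases lt_or_ge (repr (fundSeq e x)) Ordinal.omega0 with hfin | hinf
    · obtain ⟨j, hj⟩ := Ordinal.lt_omega0.1 hfin
      have hle := repr_fundSeq_le he h0 hs hfin
      have heq : fundSeq e x = ofNat j := repr_inj.1 (by rw [hj, repr_ofNat])
      rw [hj] at hle
      have hjx : j ≤ x + 1 := by exact_mod_cast hle
      rw [heq]
      refine (hardy_opow_ofNat_add_le (by omega) j x).trans ?_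
      refine Descends.fastGrow_le (by omega) (Descends.of_isLean (z := m + j) (by omega) he
        (nf_ofNat _) ?_ (isLean_ofNat _))
      rw [le_def, repr_ofNat]
      exact (Ordinal.natCast_lt_omega0 _).le.trans hω
    · refine (hardy_opow_add_le_fastGrow m (fundSeq e x) hnf hinf x).trans ?_
      rw [fastGrow_limit hs]
      exact (Descends.fundSeq_of_le (Nat.le_add_right x _) (by omega) hs).fastGrow_le (by omega)
  · have hlt := fundSeq_lt e 0 h0
    refine hardy_opow_add_le_succ hs hs (hardy_opow_add_le_fastGrow m (fundSeq e 0)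
      (fundSeq_nf he 0) ?_) x
    by_contra hcon
    rw [not_le] at hcon
    obtain ⟨j, hj⟩ := Ordinal.lt_omega0.1 hcon
    rw [isSucc_repr e 0 hs, hj] at hω
    exact absurd (Ordinal.natCast_lt_omega0 (j + 1)) (by simpa using hω.not_gt)
termination_by e

theorem omega0_le_repr_towerNote {k : ℕ} (hk : 1 ≤ k) : Ordinal.omega0 ≤ repr (towerNote k) := by
  obtain ⟨k, rfl⟩ := Nat.exists_eq_add_of_le' hk
  refine omega0_le_repr_oadd ?_ _ _
  cases k <;> exact nofun

/-- Raising the leading coefficient of `α` absorbs one more application of `h` to `h^α(x)`. -/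
theorem exists_hardy_ge {h : ℕ → ℕ} (hm : Monotone h) (hh : ∀ x, x < h x) {ℓ k : ℕ} {α : ONote}
    (hα : NF α) (hk : α < towerNote (k + 1)) (hℓ : IsLean ℓ α) :
    ∃ β, NF β ∧ β < towerNote (k + 1) ∧ IsLean (ℓ + 1) β ∧
      ∀ x, 1 ≤ x → h (hardy h α x) ≤ hardy h β x := by
  have hx : ∀ x, x ≤ h x := fun x => (hh x).le
  obtain _ | ⟨e, c, a⟩ := α
  · have h1 : NFBelow (oadd 0 1 0) (repr (towerNote k)) := by
      refine NFBelow.oadd NF.zero NFBelow.zero ?_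
      cases k <;> exact lt_def.1 (oadd_pos _ _ _)
    refine ⟨oadd 0 1 0, h1.nf, (lt_towerNote_succ h1.nf).2 h1, ⟨trivial, by simp, trivial⟩, ?_⟩
    intro x _
    rw [hardy_one, zero_def, hardy_zero]
  · rw [lt_towerNote_succ hα] at hk
    have hβ : NFBelow (oadd e (c + 1) a) (repr (towerNote k)) := NFBelow.oadd hα.fst hα.snd' hk.lt
    refine ⟨_, hβ.nf, (lt_towerNote_succ hβ.nf).2 hβ, ⟨hℓ.1.mono (Nat.le_succ _), ?_,
      hℓ.2.2.mono (Nat.le_succ _)⟩, ?_⟩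
    · rw [PNat.add_coe]
      exact Nat.succ_le_succ hℓ.2.1
    · intro x h1
      have hle : 1 ≤ hardy h (oadd e c a) x :=
        h1.trans ((Nat.le_add_right _ _).trans (add_cichon_le_hardy hh _ x))
      rw [hardy_oadd_eq_iterate h e (c + 1), PNat.add_coe, PNat.one_coe,
        Function.iterate_succ_apply', ← hardy_oadd_eq_iterate, ← hardy_one h]
      exact ((Descends.zero _ e).opow hle).hardy_le hm hx

end ONote

namespace NONote

open ONote

/-- The outer function is an Ackermann function here: these are monotone and bound all primitive
recursive functions. -/
theorem exists_primrec_ack_maxLen_le {g : ℕ → ℕ} (hg : StrictMono g)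
    (hsup : ∀ x y, g x + g y ≤ g (x + y)) (hprim : Primrec g) {k : ℕ} (hk : 1 ≤ k) (m₁ : ℕ) :
    ∃ p : ℕ → ℕ, Primrec p ∧ ∀ (ℓ n : ℕ) (α : NONote), α < tower (k + 1) → IsLean ℓ α.1 →
      ack m₁ (ℓ + n + maxLen g α n) ≤ fastGrow (towerNote k) (p (ℓ + n)) := by
  obtain ⟨m₂, hm₂⟩ := exists_lt_ack_of_nat_primrec
    (Primrec.nat_iff.1 (Primrec.nat_mul.comp Primrec.id hprim))
  set m := max m₁ m₂ with hmdef
  have hm : Monotone (ack m) := (ack_strictMono_right m).monotone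
  have hlt : ∀ x, x < ack m x := lt_ack_right m
  have hle : ∀ x, x ≤ ack m x := fun x => (hlt x).le
  have hgm : ∀ x, x * g x ≤ ack m x := fun x =>
    (hm₂ x).le.trans (ack_le_ack (le_max_right _ _) le_rfl)
  refine ⟨fun s => s + s * s * k + 2 + (m + 2), ?_, ?_⟩
  · exact Primrec.nat_add.comp (Primrec.nat_add.comp (Primrec.nat_add.comp Primrec.id
      (Primrec.nat_mul.comp (Primrec.nat_mul.comp Primrec.id Primrec.id) (Primrec.const k)))
      (Primrec.const 2)) (Primrec.const (m + 2))
  · intro ℓ n α hα hℓ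
    set x := ℓ + n + (ℓ + n) * (ℓ + n) * k + 2 with hxdef
    have hxl : ℓ + ℓ * n * k ≤ x := by
      have : ℓ * n * k ≤ (ℓ + n) * (ℓ + n) * k :=
        Nat.mul_le_mul_right _ (Nat.mul_le_mul (Nat.le_add_right _ _) (Nat.le_add_left _ _))
      omega
    have hM : maxLen g α n ≤ cichon (ack m) α.1 x :=
      (maxLen_le_cichon hg hsup α hα hℓ).trans ((cichon_le_cichon hm hle hgm _ _).trans
        (cichon_mono hm hle _ hxl))
    obtain ⟨β, hβ, hβk, hβℓ, hβh⟩ := exists_hardy_ge hm hlt α.2 hα hℓ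
    calc ack m₁ (ℓ + n + maxLen g α n) ≤ ack m (hardy (ack m) α.1 x) := by
          refine ack_le_ack (le_max_left _ _) ?_
          have := add_cichon_le_hardy hlt α.1 x
          omega
      _ ≤ hardy (ack m) β x := hβh x (by omega)
      _ ≤ hardy (ack m) (towerNote (k + 1)) x :=
          (Descends.of_isLean (z := ℓ + 1) (by omega) (towerNote_nf _) hβ hβk.le hβℓ).hardy_le
            hm hle
      _ ≤ fastGrow (towerNote k) (x + (m + 2)) :=
          (Nat.le_add_right _ _).trans (hardy_opow_add_le_fastGrow m _ (towerNote_nf k)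
            (omega0_le_repr_towerNote hk) x)

end NONote

theorem mainTheorem3 (g : ℕ → ℕ) (hg : StrictMono g) (hsup : ∀ x y, g x + g y ≤ g (x + y))
    (k : ℕ) :
    -- `k` nested applications of the multiset operator give order types below `Ω_{k+1}`
    (∀ A : NestedMultiset, A.depth ≤ k + 1 → A.orderType < NONote.tower (k + 1)) ∧
    -- residuals reflect into `Rₙ(A, a)`, which reflects into `C(α')` for some `α' ∈ δₙ(o(A))`
    (∀ (A : NestedMultiset) (n : ℕ) (a : A.Carrier), A.norm a ≤ n →
      NestedMultiset.ReflectsInto {x : A.Carrier | ¬ A.le a x} (A.residual n a) ∧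
      ∃ α' ∈ NONote.deriv n A.orderType,
        NestedMultiset.ReflectsInto (Set.univ : Set (A.residual n a).Carrier)
          (NestedMultiset.canon α'.1)) ∧
    -- leanness of `Dₙ(ω ^ β)` and of the elements of `δₙ(α)`
    (∀ (ℓ n : ℕ) (β : NONote), ONote.oadd β.1 1 0 < ONote.towerNote (k + 1) →
      ONote.IsLean ℓ (ONote.oadd β.1 1 0) → ONote.IsLean (ℓ * n * k) (ONote.expDeriv n β.1)) ∧
    (∀ (ℓ n : ℕ) (α : NONote), α < NONote.tower (k + 1) → ONote.IsLean ℓ α.1 →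
      ∀ α' ∈ NONote.deriv n α, ONote.IsLean (ℓ + ℓ * n * k) α'.1) ∧
    -- the bound on `M_{α,g}(n)`
    (∀ (ℓ n : ℕ) (α : NONote), α < NONote.tower (k + 1) → ONote.IsLean ℓ α.1 →
      NONote.maxLen g α n ≤ ONote.cichon (fun x => x * g x) α.1 (ℓ + ℓ * n * k)) ∧
    -- the length function theorem
    (∀ (ℓ n : ℕ) (A : NestedMultiset), A.orderType < NONote.tower (k + 1) →
      ONote.IsLean ℓ A.orderType.1 →
      IsGreatest (A.badLengths g n) (A.lengthFun g n) ∧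
      A.lengthFun g n ≤ NONote.maxLen g A.orderType n ∧
      A.lengthFun g n ≤ ONote.cichon (fun x => x * g x) A.orderType.1 (ℓ + ℓ * n * k)) ∧
    -- for primitive recursive control, the bounds lie at level `Ω_k` of the fast-growing hierarchy
    (1 ≤ k → Primrec g → ∀ e : ℕ → ℕ, Primrec e →
      (∃ p : ℕ → ℕ, Primrec p ∧
        ∀ (ℓ n : ℕ) (α : NONote), α < NONote.tower (k + 1) → ONote.IsLean ℓ α.1 →
          e (ℓ + n + NONote.maxLen g α n) ≤ ONote.fastGrow (ONote.towerNote k) (p (ℓ + n))) ∧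
      ∀ (P : List Bool → Bool)
        (T : Turing.TM2ComputableInTime (fun w : List Bool => w) Computability.encodeBool P)
        (A : ℕ → NestedMultiset) (ℓ n : ℕ → ℕ), Primrec ℓ → Primrec n →
        (∀ N, (A N).depth ≤ k + 1) → (∀ N, ONote.IsLean (ℓ N) (A N).orderType.1) →
        (∀ N, T.time N ≤ e (N + (A N).lengthFun g (n N))) →
        DecidableInFastTime (ONote.towerNote k) P) := by
  have hack : ∀ {e : ℕ → ℕ}, Primrec e → ∃ m, ∀ n, e n < ack m n := fun he =>
    exists_lt_ack_of_nat_primrec (Primrec.nat_iff.1 he)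
  refine ⟨fun A hA => A.orderType_lt_tower hA, ?_, ?_, ?_, ?_, ?_, ?_⟩
  · intro A n a ha
    obtain ⟨α', hα', hr⟩ := A.residual_reflects_canon n a ha
    exact ⟨A.reflectsInto_residual n a ha,
      ⟨α', (ONote.derivList_spec n A.orderType.2 α' hα').1⟩, NONote.mem_deriv.2 hα',
      hr.reflectsInto_univ⟩
  · intro ℓ n β hβ hℓ
    exact ONote.IsLean.expDeriv n β.2 ((ONote.oadd_lt_towerNote_succ β.2).1 hβ) hℓ.1
  · intro ℓ n α hα hℓ α' hα'
    exact ONote.IsLean.derivList α.2 hα hℓ (NONote.mem_deriv.1 hα')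
  · intro ℓ n α hα hℓ
    exact NONote.maxLen_le_cichon hg hsup α hα hℓ
  · intro ℓ n A hA hℓ
    have hM := A.lengthFun_le_maxLen g n
    exact ⟨A.isGreatest_lengthFun g n, hM,
      hM.trans (NONote.maxLen_le_cichon hg hsup A.orderType hA hℓ)⟩
  · intro hk hprim e he
    obtain ⟨m, hm⟩ := hack he
    obtain ⟨p, hp, hbound⟩ := NONote.exists_primrec_ack_maxLen_le hg hsup hprim hk m
    refine ⟨⟨p, hp, fun ℓ n α hα hℓ => (hm _).le.trans (hbound ℓ n α hα hℓ)⟩, ?_⟩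
    intro P T A ℓ n hℓp hnp hdepth hlean hT
    refine ⟨fun N => p (ℓ N + N + n N), hp.comp (Primrec.nat_add.comp
      (Primrec.nat_add.comp hℓp Primrec.id) hnp), T, fun N => ?_⟩
    refine ((hT N).trans (hm _).le).trans (le_trans ?_ (hbound (ℓ N + N) (n N) (A N).orderType
      (NestedMultiset.orderType_lt_tower (hdepth N)) ((hlean N).mono (Nat.le_add_right _ _))))
    -- `e` need not be monotone, but its Ackermann bound is
    refine ack_le_ack le_rfl ?_
    have := (A N).lengthFun_le_maxLen g (n N)
    omega
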